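/- For $v=(v_1,\dots,v_{n+1})\in\mathbb{R}^{n+1}$ write $\overline{v}=(v_1,\dots,v_n)$ and $v^z=v_{n+1}$. Let $n\ge 1$, $a<b$, and put $$\Delta_c^k=\{r\in\mathbb{R}^k: r_j\ge 0,\ r_1+\dots+r_k\le 1\},\qquad \Delta_*^k=\{y\in\mathbb{R}^k: a\le y_1\le\dots\le y_k\le b\}.$$ Let $\gamma:[a,b]\to\mathbb{R}^{n+1}$ be continuous on $[a,b]$ and $C^{n+1}$ on $(a,b)$, with totally positive torsion, i.e. for every $t\in(a,b)$ all leading principal minors of the matrix $(\gamma'(t),\dots,\gamma^{(n+1)}(t))$ (columns) are positive. Let $\overline\gamma=(\gamma_1,\dots,\gamma_n)$ and $K=\mathrm{conv}(\overline\gamma([a,b]))\subset\mathbb{R}^n$. If $n=2\ell$, let $D_U=D_L=\Delta_c^{\ell}\times\Delta_*^{\ell}$ and $$U(\lambda,x)=\sum_{j=1}^{\ell}\lambda_j\gamma(x_j)+\Big(1-\sum_{j=1}^{\ell}\lambda_j\Big)\gamma(b),\qquad L(\lambda,x)=\Big(1-\sum_{j=1}^{\ell}\lambda_j\Big)\gamma(a)+\sum_{j=1}^{\ell}\lambda_j\gamma(x_j).$$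 If $n=2\ell-1$, let $D_U=\Delta_c^{\ell}\times\Delta_*^{\ell-1}$, $D_L=\Delta_c^{\ell-1}\times\Delta_*^{\ell}$ and $$U(\beta_1,\dots,\beta_\ell,x_2,\dots,x_\ell)=\Big(1-\sum_{j=1}^{\ell}\beta_j\Big)\gamma(a)+\sum_{j=2}^{\ell}\beta_j\gamma(x_j)+\beta_1\gamma(b),$$ $$L(\beta_2,\dots,\beta_\ell,x_1,\dots,x_\ell)=\Big(1-\sum_{j=2}^{\ell}\beta_j\Big)\gamma(x_1)+\sum_{j=2}^{\ell}\beta_j\gamma(x_j).$$ Then: 1. $\overline U(\partial D_U)=\overline L(\partial D_L)=\partial K$, and $\overline U:\mathrm{int}\,D_U\to\mathrm{int}\,K$ and $\overline L:\mathrm{int}\,D_L\to\mathrm{int}\,K$ are diffeomorphisms (of class $C^{n+1}$). 2. The functions $B^{\sup}$ and $B^{\inf}$ given by $B^{\sup}(\overline U(p))=U^z(p)$ for $p\in D_U$ and $B^{\inf}(\overline L(p))=L^z(p)$ for $p\in D_L$ are well defined on $K$: $\overline U(D_U)=\overline L(D_L)=K$, $\overline U(p)=\overline U(q)$ implies $U^z(p)=U^z(q)$,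 and $\overline L(p)=\overline L(q)$ implies $L^z(p)=L^z(q)$. Both are continuous on $K$ and $C^1$ on $\mathrm{int}\,K$. 3. If $n\ge 2$, then $B^{\sup}$ is the minimal concave function on $K$ with $B^{\sup}(\overline\gamma(t))=\gamma_{n+1}(t)$ for all $t\in[a,b]$, i.e. it is concave, has these values, and satisfies $B^{\sup}\le G$ on $K$ for every concave $G:K\to\mathbb{R}$ with these values; if $n=1$, it is the minimal concave function on $K$ with $B^{\sup}(\overline\gamma(t))\ge\gamma_2(t)$ for all $t\in[a,b]$. For all $n\ge 1$, $B^{\inf}$ is the maximal convex function on $K$ with $B^{\inf}(\overline\gamma(t))=\gamma_{n+1}(t)$ for all $t\in[a,b]$. 4. For $y\in K$, $B^{\inf}(y)=B^{\sup}(y)$ if and only if $y\in\partial K$. Moreover, $$\partial\,\mathrm{conv}(\gamma([a,b]))=\{(x,B^{\sup}(x)):x\in K\}\cup\{(x,B^{\inf}(x)):x\in K\}.$$ -/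

import Mathlib

/-- The projection `v̄ = (v₁, …, vₙ)` of `v ∈ ℝⁿ⁺¹` onto the first `n` coordinates. -/
def bar {n : ℕ} (v : Fin (n + 1) → ℝ) : Fin n → ℝ := fun i => v i.castSucc

/-- The last coordinate `v^z = vₙ₊₁` of `v ∈ ℝⁿ⁺¹`. -/
def zc {n : ℕ} (v : Fin (n + 1) → ℝ) : ℝ := v (Fin.last n)

/-- The point `(x, z) ∈ ℝⁿ⁺¹` for `x ∈ ℝⁿ` and `z ∈ ℝ`. -/
def joinLast {n : ℕ} (x : Fin n → ℝ) (z : ℝ) : Fin (n + 1) → ℝ :=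
  Fin.snoc (α := fun _ => ℝ) x z

/-- `γ` has totally positive torsion on `(a,b)`: at every `t ∈ (a,b)` all leading principal minors
of the `d × d` matrix with columns `γ'(t), …, γ⁽ᵈ⁾(t)` are positive. -/
def TotallyPositiveTorsion {d : ℕ} (γ : ℝ → Fin d → ℝ) (a b : ℝ) : Prop :=
  ∀ t ∈ Set.Ioo a b, ∀ (k : ℕ) (hk : k ≤ d),
    0 < (Matrix.of fun i j : Fin k =>
      iteratedDeriv ((j : ℕ) + 1) γ t (Fin.castLE hk i)).det

/-- `Δ_c^k`: nonnegative `k`-tuples with sum at most `1`. -/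
def DeltaC (k : ℕ) : Set (Fin k → ℝ) := {r | (∀ j, 0 ≤ r j) ∧ ∑ j, r j ≤ 1}

/-- `Δ_*^k`: nondecreasing `k`-tuples of points of `[a,b]`. -/
def DeltaStar (a b : ℝ) (k : ℕ) : Set (Fin k → ℝ) := {y | (∀ j, y j ∈ Set.Icc a b) ∧ Monotone y}

/-- The map `U_{2ℓ}`. -/
def upperEven {d : ℕ} (γ : ℝ → Fin d → ℝ) (b : ℝ) (ℓ : ℕ)
    (p : (Fin ℓ → ℝ) × (Fin ℓ → ℝ)) : Fin d → ℝ :=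
  ∑ j, p.1 j • γ (p.2 j) + (1 - ∑ j, p.1 j) • γ b

/-- The map `L_{2ℓ}`. -/
def lowerEven {d : ℕ} (γ : ℝ → Fin d → ℝ) (a : ℝ) (ℓ : ℕ)
    (p : (Fin ℓ → ℝ) × (Fin ℓ → ℝ)) : Fin d → ℝ :=
  (1 - ∑ j, p.1 j) • γ a + ∑ j, p.1 j • γ (p.2 j)

/-- The map `U_{2ℓ-1}` for `ℓ = m + 1`; the coordinates are `(β₁, …, β_ℓ, x₂, …, x_ℓ)`, so that
`p.1 0 = β₁`, and `p.1 j.succ`, `p.2 j` carry the same one-based index `j + 2`. -/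
def upperOdd {d : ℕ} (γ : ℝ → Fin d → ℝ) (a b : ℝ) (m : ℕ)
    (p : (Fin (m + 1) → ℝ) × (Fin m → ℝ)) : Fin d → ℝ :=
  (1 - ∑ j, p.1 j) • γ a + ∑ j : Fin m, p.1 j.succ • γ (p.2 j) + p.1 0 • γ b

/-- The map `L_{2ℓ-1}` for `ℓ = m + 1`; the coordinates are `(β₂, …, β_ℓ, x₁, …, x_ℓ)`, so that
`p.2 0 = x₁`, and `p.1 j`, `p.2 j.succ` carry the same one-based index `j + 2`. -/
def lowerOdd {d : ℕ} (γ : ℝ → Fin d → ℝ) (m : ℕ)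
    (p : (Fin m → ℝ) × (Fin (m + 1) → ℝ)) : Fin d → ℝ :=
  (1 - ∑ j, p.1 j) • γ (p.2 0) + ∑ j : Fin m, p.1 j • γ (p.2 j.succ)

/-- `F` restricts to a `C^r` diffeomorphism of `s` onto `t` (used for open sets `s` and `t`). -/
def IsDiffeoOn {E G : Type*} [NormedAddCommGroup E] [NormedSpace ℝ E]
    [NormedAddCommGroup G] [NormedSpace ℝ G] (r : ℕ) (F : E → G) (s : Set E) (t : Set G) : Prop :=
  Set.BijOn F s t ∧ ContDiffOn ℝ r F s ∧
    ∃ F' : G → E, Set.InvOn F' F s t ∧ ContDiffOn ℝ r F' t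

/-- `B` is the minimal one among the concave functions on `K` with the property `P`. -/
def IsMinimalConcave {E : Type*} [AddCommGroup E] [Module ℝ E] (K : Set E) (P : (E → ℝ) → Prop)
    (B : E → ℝ) : Prop :=
  ConcaveOn ℝ K B ∧ P B ∧ ∀ G : E → ℝ, ConcaveOn ℝ K G → P G → ∀ x ∈ K, B x ≤ G x

/-- `B` is the maximal one among the convex functions on `K` with the property `P`. -/
def IsMaximalConvex {E : Type*} [AddCommGroup E] [Module ℝ E] (K : Set E) (P : (E → ℝ) → Prop)
    (B : E → ℝ) : Prop :=
  ConvexOn ℝ K B ∧ P B ∧ ∀ G : E → ℝ, ConvexOn ℝ K G → P G → ∀ x ∈ K, G x ≤ B x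

/-- `B` is a function with `B (F̄ p) = F^z p` for all parameters `p ∈ D`. -/
def IsGraphFunction {n : ℕ} {X : Type*} (D : Set X) (F : X → Fin (n + 1) → ℝ)
    (B : (Fin n → ℝ) → ℝ) : Prop :=
  ∀ p ∈ D, B (bar (F p)) = zc (F p)

/-- The assertions about the boundary of the convex hull of the curve `γ : [a,b] → ℝⁿ⁺¹`, for
parametrizations `U` on `DU` (upper hull) and `L` on `DL` (lower hull); `K` stands for the convex
hull of the projected curve `γ̄`. -/
structure DescribesHull {n : ℕ} (γ : ℝ → Fin (n + 1) → ℝ) (a b : ℝ)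
    {X Y : Type*} [NormedAddCommGroup X] [NormedSpace ℝ X]
    [NormedAddCommGroup Y] [NormedSpace ℝ Y]
    (DU : Set X) (U : X → Fin (n + 1) → ℝ) (DL : Set Y) (L : Y → Fin (n + 1) → ℝ)
    (K : Set (Fin n → ℝ)) : Prop where
  boundary_upper : (fun p => bar (U p)) '' frontier DU = frontier K
  boundary_lower : (fun p => bar (L p)) '' frontier DL = frontier K
  diffeo_upper : IsDiffeoOn (n + 1) (fun p => bar (U p)) (interior DU) (interior K)
  diffeo_lower : IsDiffeoOn (n + 1) (fun p => bar (L p)) (interior DL) (interior K)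
  /-- `B^sup` and `B^inf` are defined on all of `K` … -/
  image_upper : (fun p => bar (U p)) '' DU = K
  image_lower : (fun p => bar (L p)) '' DL = K
  /-- … and their values do not depend on the choice of the parameter. -/
  wellDefined_upper : ∀ p ∈ DU, ∀ q ∈ DU, bar (U p) = bar (U q) → zc (U p) = zc (U q)
  wellDefined_lower : ∀ p ∈ DL, ∀ q ∈ DL, bar (L p) = bar (L q) → zc (L p) = zc (L q)
  /-- The assertions about `B^sup` and `B^inf`, which are uniquely determined on `K`. -/
  graphFunctions : ∀ Bsup Binf : (Fin n → ℝ) → ℝ,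
    IsGraphFunction DU U Bsup → IsGraphFunction DL L Binf →
      ContinuousOn Bsup K ∧ ContDiffOn ℝ 1 Bsup (interior K) ∧
      ContinuousOn Binf K ∧ ContDiffOn ℝ 1 Binf (interior K) ∧
      (n = 1 → IsMinimalConcave K (fun G => ∀ t ∈ Set.Icc a b, zc (γ t) ≤ G (bar (γ t))) Bsup) ∧
      (2 ≤ n → IsMinimalConcave K (fun G => ∀ t ∈ Set.Icc a b, G (bar (γ t)) = zc (γ t)) Bsup) ∧
      IsMaximalConvex K (fun G => ∀ t ∈ Set.Icc a b, G (bar (γ t)) = zc (γ t)) Binf ∧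
      (∀ y ∈ K, Binf y = Bsup y ↔ y ∈ frontier K) ∧
      frontier (convexHull ℝ (γ '' Set.Icc a b)) =
        (fun x => joinLast x (Bsup x)) '' K ∪ (fun x => joinLast x (Binf x)) '' K

/-! Everything rests on counting zeros. Positive torsion says that all Wronskians of `γ₁', …, γₙ₊₁'`
are positive. Dividing such a system by its first function and differentiating gives a shorter
system of the same kind, so Rolle's theorem shows inductively that a nontrivial combination of `k`
of its functions has at most `k - 1` zeros, and fixes the sign to the right of `k - 1` zeros when
the leading coefficient is positive. One more use of Rolle bounds by `n` the zeros on `γ̄` of an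
affine function with nonzero linear part, double zeros in `(a, b)` counting twice.

Let the weight of a finite set of nodes in `[a, b]` count interior points twice and endpoints once.
Nodes of weight at most `n` lie on a supporting hyperplane of `γ̄`. For nodes of weight `n + 1`,
Hermite interpolation gives an affine function whose graph meets `γ` exactly at the nodes and has
`γ` on one side: below it if `b` is a node, above it otherwise.

All four maps are convex combinations of curve points. At interior parameters the nodes have weight
exactly `n + 1`, and `b` is among them for `U` but not for `L`; hence `U` is the top and `L` the
bottom of the fibre of the hull. At boundary parameters the weight drops to at most `n`, so the
image lies on `∂K`. Hermite interpolation also makes the node points and tangents independent, so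
the derivative of the projected map is invertible; the contact set determines the nodes and then the
weights, which gives injectivity. The image of the interior is open, and closed relative to `int K`,
so it is all of `int K` by connectedness. Over `∂K` the fibre is a single point, since a supporting
hyperplane meets the curve in at most `n` points, where the last coordinate can be interpolated
affinely.

Concavity and convexity follow from extremality, optimality from Jensen's inequality, and strict
separation over `int K` from the contact sets differing at `b`. -/

open Set Filter Topology

/-! ### Wronskians and Pólya systems -/

/-- The Wronskian of the first `k` functions of a sequence. -/
noncomputable def wronskian (g : ℕ → ℝ → ℝ) (k : ℕ) (t : ℝ) : ℝ :=
  (Matrix.of fun i j : Fin k => iteratedDeriv (j : ℕ) (g i) t).det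

/-- Leibniz's rule factors the Wronskian matrix of the products through a triangular matrix with
diagonal entries `f t`. -/
lemma wronskian_mul_left {f : ℝ → ℝ} {h : ℕ → ℝ → ℝ} {k : ℕ} {t : ℝ}
    (hf : ∀ j < k, ContDiffAt ℝ j f t) (hh : ∀ i < k, ∀ j < k, ContDiffAt ℝ j (h i) t) :
    wronskian (fun i => h i * f) k t = wronskian h k t * f t ^ k := by
  set T : Matrix (Fin k) (Fin k) ℝ := Matrix.of fun m j =>
    if (m : ℕ) ≤ j then ((j : ℕ).choose m : ℝ) * iteratedDeriv ((j : ℕ) - m) f t else 0 with hT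
  have hM : (Matrix.of fun i j : Fin k => iteratedDeriv (j : ℕ) (h i * f) t) =
      (Matrix.of fun i j : Fin k => iteratedDeriv (j : ℕ) (h i) t) * T := by
    ext i j
    simp only [Matrix.mul_apply, Matrix.of_apply, hT]
    rw [iteratedDeriv_mul (hh i i.2 j j.2) (hf j j.2),
      Finset.sum_fin_eq_sum_range, ← Finset.sum_subset
        (Finset.range_subset_range.2 (Nat.succ_le_of_lt j.2))]
    · refine Finset.sum_congr rfl fun m hm => ?_
      have hm' : m ≤ (j : ℕ) := Nat.lt_succ_iff.1 (Finset.mem_range.1 hm)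
      rw [dif_pos (hm'.trans_lt j.2), if_pos hm']
      ring
    · intro m hm hm'
      have : ¬ m ≤ (j : ℕ) := fun h => hm' (Finset.mem_range.2 (Nat.lt_succ_of_le h))
      rw [dif_pos (Finset.mem_range.1 hm), if_neg this, mul_zero]
  have hdet : T.det = f t ^ k := by
    rw [Matrix.det_of_isUpperTriangular]
    · simp [hT]
    · intro i j hij
      rw [hT, Matrix.of_apply, if_neg (not_le.2 (show (j : ℕ) < i from hij))]
  rw [wronskian, wronskian, hM, Matrix.det_mul, hdet]

/-- The row of the constant function is `(1, 0, …, 0)`; expanding along it leaves the Wronskian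
matrix of the derivatives. -/
lemma wronskian_one_cons {h : ℕ → ℝ → ℝ} {k : ℕ} {t : ℝ} (h0 : h 0 = fun _ => 1) :
    wronskian h (k + 1) t = wronskian (fun i => deriv (h (i + 1))) k t := by
  rw [wronskian, wronskian, Matrix.det_succ_row_zero, Finset.sum_eq_single 0]
  · simp only [Fin.val_zero, pow_zero, one_mul, Matrix.of_apply, h0, iteratedDeriv_zero]
    congr 1
    ext i j
    simp [iteratedDeriv_succ']
  · intro j _ hj
    have : (j : ℕ) ≠ 0 := fun h => hj (Fin.ext h)
    simp [h0, iteratedDeriv_const, this]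
  · simp

lemma wronskian_congr {g h : ℕ → ℝ → ℝ} {k : ℕ} {t : ℝ}
    (H : ∀ i < k, g i =ᶠ[𝓝 t] h i) : wronskian g k t = wronskian h k t := by
  unfold wronskian
  congr 1
  ext i j
  exact ((H i i.2).iteratedDeriv j).eq_of_nhds

/-- The first `k` functions of `g` have all their Wronskians positive on `(a, b)`. -/
structure IsPolyaSystem (a b : ℝ) (k : ℕ) (g : ℕ → ℝ → ℝ) : Prop where
  smooth : ∀ i < k, ∀ j < k, ContDiffOn ℝ j (g i) (Ioo a b)
  pos : ∀ j ≤ k, ∀ t ∈ Ioo a b, 0 < wronskian g j t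

namespace IsPolyaSystem

variable {a b : ℝ} {k : ℕ} {g : ℕ → ℝ → ℝ}

lemma mono (hg : IsPolyaSystem a b k g) {l : ℕ} (hl : l ≤ k) : IsPolyaSystem a b l g :=
  ⟨fun i hi j hj => hg.smooth i (hi.trans_le hl) j (hj.trans_le hl),
    fun j hj => hg.pos j (hj.trans hl)⟩

lemma zero_pos (hg : IsPolyaSystem a b (k + 1) g) {t : ℝ} (ht : t ∈ Ioo a b) : 0 < g 0 t := by
  simpa [wronskian] using hg.pos 1 (by omega) t ht

lemma contDiffOn_div (hg : IsPolyaSystem a b (k + 1) g) {i j : ℕ} (hi : i < k + 1)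
    (hj : j < k + 1) : ContDiffOn ℝ j (fun t => g i t / g 0 t) (Ioo a b) :=
  (hg.smooth i hi j hj).div (hg.smooth 0 (by omega) j hj) fun _ ht => (hg.zero_pos ht).ne'

/-- Dividing by the first function and differentiating reduces the length of the system. -/
lemma reduce (hg : IsPolyaSystem a b (k + 1) g) :
    IsPolyaSystem a b k (fun i => deriv fun t => g (i + 1) t / g 0 t) := by
  refine ⟨fun i hi j hj => ?_, fun j hj t ht => ?_⟩
  · have := hg.contDiffOn_div (i := i + 1) (j := j + 1) (by omega) (by omega)
    exact this.deriv_of_isOpen isOpen_Ioo (by norm_cast)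
  · have hn : Ioo a b ∈ 𝓝 t := isOpen_Ioo.mem_nhds ht
    -- The quotient `g 0 / g 0` is replaced by the constant `1`, with which it is only known to
    -- agree on `(a, b)`.
    set q : ℕ → ℝ → ℝ := fun i => if i = 0 then fun _ => 1 else fun t => g i t / g 0 t with hq
    have h1 : wronskian g (j + 1) t = wronskian (fun i => q i * g 0) (j + 1) t := by
      refine wronskian_congr fun i _ => ?_
      filter_upwards [hn] with s hs
      have := (hg.zero_pos hs).ne'
      by_cases hi : i = 0
      · simp [hq, hi]
      · simp [hq, hi, this]
    rw [wronskian_mul_left, wronskian_one_cons (h := q) (by simp [hq])] at h1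
    · have h2 := hg.pos (j + 1) (by omega) t ht
      rw [h1] at h2
      have h3 := pos_of_mul_pos_left h2 (pow_pos (hg.zero_pos ht) _).le
      simpa [hq] using h3
    · exact fun l hl => (hg.smooth 0 (by omega) l (by omega)).contDiffAt hn
    · intro i hi l hl
      by_cases h : i = 0
      · simp only [hq, h, if_true]
        exact contDiffAt_const
      · simp only [hq, h, if_false]
        exact (hg.contDiffOn_div (by omega) (by omega)).contDiffAt hn

end IsPolyaSystem

/-! ### Zero counting and Chebyshev systems -/

/-- Rolle's theorem for finitely many zeros, some of them double. -/
lemma exists_zeros_deriv {S : Set ℝ} (hS : S.OrdConnected) {Q : ℝ → ℝ} (hQ : ContinuousOn Q S)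
    (Z : Finset ℝ) :
    ∀ D ⊆ Z, (∀ z ∈ Z, z ∈ S ∧ Q z = 0) → (∀ z ∈ D, deriv Q z = 0) → Z.Nonempty →
      ∃ Z' : Finset ℝ, Z'.card + 1 = Z.card + D.card ∧ (∀ z ∈ Z', deriv Q z = 0) ∧
        ∀ z ∈ Z', z ∈ D ∨ ∃ x ∈ Z, ∃ y ∈ Z, x < z ∧ z < y := by
  classical
  induction Z using Finset.induction_on_max with
  | empty => simp
  | insert m s hm ih =>
    intro D hD hZ hdD _
    have hms : m ∉ s := fun h => lt_irrefl _ (hm m h)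
    rcases s.eq_empty_or_nonempty with rfl | hs
    · refine ⟨D, ?_, hdD, fun z hz => Or.inl hz⟩
      simp [add_comm]
    · obtain ⟨Z', hc, hz', hloc⟩ := ih (D.erase m)
        (fun z hz => by
          have := hD (Finset.mem_of_mem_erase hz)
          exact (Finset.mem_insert.1 this).resolve_left (Finset.ne_of_mem_erase hz))
        (fun z hz => hZ z (Finset.mem_insert_of_mem hz))
        (fun z hz => hdD z (Finset.mem_of_mem_erase hz)) hs
      have hxs := s.max'_mem hs
      set x := s.max' hs with hx
      have hxm : x < m := hm x hxs
      obtain ⟨c, hc1, hc2⟩ := exists_deriv_eq_zero hxm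
        (hQ.mono (hS.out (hZ x (Finset.mem_insert_of_mem hxs)).1 (hZ m (Finset.mem_insert_self _ _)).1))
        (by rw [(hZ x (Finset.mem_insert_of_mem hxs)).2, (hZ m (Finset.mem_insert_self _ _)).2])
      -- All points found so far lie at or left of `x`, so the Rolle point in `(x, m)` is new; `m`
      -- itself adds another when it is a double zero.
      have hle : ∀ z ∈ Z', z ≤ x := by
        intro z hz
        rcases hloc z hz with h | ⟨_, _, y, hy, _, h⟩
        · have := hD (Finset.mem_of_mem_erase h)
          exact s.le_max' z ((Finset.mem_insert.1 this).resolve_left (Finset.ne_of_mem_erase h))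
        · exact h.le.trans (s.le_max' y hy)
      have hcZ : c ∉ Z' := fun h => absurd (hle c h) (not_le.2 hc1.1)
      have hloc' : ∀ z ∈ insert c Z', z ∈ D ∨
          ∃ x ∈ insert m s, ∃ y ∈ insert m s, x < z ∧ z < y := by
        intro z hz
        rcases Finset.mem_insert.1 hz with rfl | hz
        · exact Or.inr ⟨x, Finset.mem_insert_of_mem hxs, m, Finset.mem_insert_self _ _, hc1.1, hc1.2⟩
        · rcases hloc z hz with h | ⟨u, hu, y, hy, h⟩
          · exact Or.inl (Finset.mem_of_mem_erase h)
          · exact Or.inr ⟨u, Finset.mem_insert_of_mem hu, y, Finset.mem_insert_of_mem hy, h⟩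
      have hzero : ∀ z ∈ insert c Z', deriv Q z = 0 := by
        intro z hz
        rcases Finset.mem_insert.1 hz with rfl | hz
        exacts [hc2, hz' z hz]
      by_cases hmD : m ∈ D
      · refine ⟨insert m (insert c Z'), ?_, ?_, ?_⟩
        · have : m ∉ insert c Z' := by
            rw [Finset.mem_insert]
            rintro (h | h)
            · exact hc1.2.ne' h
            · exact absurd (hle m h) (not_le.2 hxm)
          rw [Finset.card_insert_of_notMem this, Finset.card_insert_of_notMem hcZ,
            Finset.card_insert_of_notMem hms]
          have := Finset.card_erase_add_one hmD
          omega
        · intro z hz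
          rcases Finset.mem_insert.1 hz with rfl | hz
          exacts [hdD _ hmD, hzero z hz]
        · intro z hz
          rcases Finset.mem_insert.1 hz with rfl | hz
          exacts [Or.inl hmD, hloc' z hz]
      · refine ⟨insert c Z', ?_, hzero, hloc'⟩
        rw [Finset.card_insert_of_notMem hcZ, Finset.card_insert_of_notMem hms]
        rw [Finset.erase_eq_of_notMem hmD] at hc
        omega

/-- The bound on zeros, and the sign to the right of the last one, for combinations of
the first `k` functions of `g` on `(a, b)`. -/
def IsChebyshev (a b : ℝ) (k : ℕ) (g : ℕ → ℝ → ℝ) : Prop :=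
  (∀ c : ℕ → ℝ, ∀ Z D : Finset ℝ, D ⊆ Z →
    (∀ z ∈ Z, z ∈ Ioo a b ∧ ∑ i ∈ Finset.range k, c i * g i z = 0) →
    (∀ z ∈ D, deriv (fun t => ∑ i ∈ Finset.range k, c i * g i t) z = 0) →
    k ≤ Z.card + D.card → ∀ i < k, c i = 0) ∧
  (∀ c : ℕ → ℝ, ∀ Z : Finset ℝ,
    (∀ z ∈ Z, z ∈ Ioo a b ∧ ∑ i ∈ Finset.range k, c i * g i z = 0) →
    k = Z.card + 1 → 0 < c (k - 1) → ∀ t ∈ Ioo a b, (∀ z ∈ Z, z < t) →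
      0 < ∑ i ∈ Finset.range k, c i * g i t)

namespace IsChebyshev

variable {a b : ℝ} {k : ℕ} {h : ℕ → ℝ → ℝ} {S : Set ℝ} {Q : ℝ → ℝ} {c : ℕ → ℝ} {Z D : Finset ℝ}

/-- Rolle points are double zeros or lie strictly between two points of `S`, so they fall in the
open interval even if `Z` contains endpoints. This allows `S` to be either `Ioo a b` or `Icc a b`.
-/
lemma exists_zeros (hS : S.OrdConnected) (hSI : S ⊆ Icc a b)
    (hQ : ContinuousOn Q S)
    (hd : ∀ t ∈ Ioo a b, HasDerivAt Q (∑ i ∈ Finset.range k, c i * h i t) t)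
    (hDZ : D ⊆ Z) (hZ : ∀ z ∈ Z, z ∈ S ∧ Q z = 0)
    (hD : ∀ z ∈ D, z ∈ Ioo a b ∧ deriv Q z = 0) (hne : Z.Nonempty) :
    ∃ Z' : Finset ℝ, Z'.card + 1 = Z.card + D.card ∧
      (∀ z ∈ Z', z ∈ Ioo a b ∧ ∑ i ∈ Finset.range k, c i * h i z = 0) ∧
      ∀ z ∈ Z', ∃ x ∈ Z, z ≤ x := by
  obtain ⟨Z', h1, h2, h3⟩ := exists_zeros_deriv hS hQ Z D hDZ hZ (fun z hz => (hD z hz).2) hne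
  have h4 : ∀ z ∈ Z', z ∈ Ioo a b := by
    intro z hz
    rcases h3 z hz with h | ⟨x, hx, y, hy, hxz, hzy⟩
    · exact (hD z h).1
    · exact ⟨(hSI (hZ x hx).1).1.trans_lt hxz, hzy.trans_le (hSI (hZ y hy).1).2⟩
  refine ⟨Z', h1, fun z hz => ⟨h4 z hz, ?_⟩, fun z hz => ?_⟩
  · rw [← (hd z (h4 z hz)).deriv, h2 z hz]
  · rcases h3 z hz with h | ⟨x, hx, y, hy, hxz, hzy⟩
    · exact ⟨z, hDZ h, le_rfl⟩
    · exact ⟨y, hy, hzy.le⟩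

/-- A primitive of a combination of `k` functions of a Chebyshev system with `k + 1` zeros has
all coefficients zero. -/
lemma primitive_coeff_eq_zero (hh : IsChebyshev a b k h) (hS : S.OrdConnected)
    (hSI : S ⊆ Icc a b) (hQ : ContinuousOn Q S)
    (hd : ∀ t ∈ Ioo a b, HasDerivAt Q (∑ i ∈ Finset.range k, c i * h i t) t)
    (hDZ : D ⊆ Z) (hZ : ∀ z ∈ Z, z ∈ S ∧ Q z = 0)
    (hD : ∀ z ∈ D, z ∈ Ioo a b ∧ deriv Q z = 0) (hk : k + 1 ≤ Z.card + D.card) :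
    ∀ i < k, c i = 0 := by
  have hne : Z.Nonempty := by
    rw [Finset.nonempty_iff_ne_empty]
    rintro rfl
    simp [Finset.subset_empty.1 hDZ] at hk
  obtain ⟨Z', h1, h2, _⟩ := exists_zeros hS hSI hQ hd hDZ hZ hD hne
  exact hh.1 c Z' ∅ (by simp) h2 (by simp) (by simp; omega)

/-- A primitive with `k` zeros of a combination with positive leading coefficient strictly
increases to the right of the zeros of its derivative. -/
lemma exists_strictMonoOn_primitive (hh : IsChebyshev a b k h) (hS : S.OrdConnected)
    (hSI : S ⊆ Icc a b) (hQ : ContinuousOn Q S)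
    (hd : ∀ t ∈ Ioo a b, HasDerivAt Q (∑ i ∈ Finset.range k, c i * h i t) t)
    (hDZ : D ⊆ Z) (hZ : ∀ z ∈ Z, z ∈ S ∧ Q z = 0)
    (hD : ∀ z ∈ D, z ∈ Ioo a b ∧ deriv Q z = 0) (hk : k = Z.card + D.card) (hne : Z.Nonempty)
    (hc : 0 < c (k - 1)) :
    ∃ Z' : Finset ℝ, (∀ z ∈ Z', z ∈ Ioo a b) ∧ (∀ z ∈ Z', ∃ x ∈ Z, z ≤ x) ∧
      ∀ r ∈ S, (∀ z ∈ Z', z ≤ r) → ∀ t ∈ S, r < t → Q r < Q t := by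
  obtain ⟨Z', h1, h2, h3⟩ := exists_zeros hS hSI hQ hd hDZ hZ hD hne
  refine ⟨Z', fun z hz => (h2 z hz).1, h3, fun r hr hrZ t ht hrt => ?_⟩
  have hsub : Icc r t ⊆ S := hS.out hr ht
  refine strictMonoOn_of_deriv_pos (convex_Icc r t) (hQ.mono hsub) (fun s hs => ?_)
    (left_mem_Icc.2 hrt.le) (right_mem_Icc.2 hrt.le) hrt
  rw [interior_Icc] at hs
  have hs' : s ∈ Ioo a b := ⟨(hSI hr).1.trans_lt hs.1, hs.2.trans_le (hSI ht).2⟩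
  rw [(hd s hs').deriv]
  exact hh.2 c Z' h2 (by omega) hc s hs' fun z hz => (hrZ z hz).trans_lt hs.1

end IsChebyshev

/-- Dividing a combination by `g 0` keeps its zeros, double ones included, and its sign. The
derivative of the quotient is a combination of the reduced system with coefficients shifted by one,
so induction applies. -/
lemma IsPolyaSystem.isChebyshev {a b : ℝ} {k : ℕ} {g : ℕ → ℝ → ℝ} (hg : IsPolyaSystem a b k g) :
    IsChebyshev a b k g := by
  induction k generalizing g with
  | zero => exact ⟨fun _ _ _ _ _ _ _ i hi => absurd hi (by omega), fun _ _ _ h => by omega⟩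
  | succ k ih =>
    have hh := ih hg.reduce
    have hdiff : 0 < k → ∀ i < k + 1, ∀ t ∈ Ioo a b, DifferentiableAt ℝ (g i) t := by
      intro hk i hi t ht
      exact ((hg.smooth i hi 1 (by omega)).contDiffAt (isOpen_Ioo.mem_nhds ht)).differentiableAt
        (by simp)
    have hpos : ∀ t ∈ Ioo a b, 0 < g 0 t := fun t ht => hg.zero_pos ht
    have hQval : ∀ c : ℕ → ℝ, ∀ t, (∑ i ∈ Finset.range (k + 1), c i * g i t) / g 0 t =
        ∑ i ∈ Finset.range (k + 1), c i * (g i t / g 0 t) := by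
      intro c t
      rw [Finset.sum_div]
      exact Finset.sum_congr rfl fun i _ => by ring
    have hcont : ∀ c : ℕ → ℝ, ContinuousOn
        (fun t => (∑ i ∈ Finset.range (k + 1), c i * g i t) / g 0 t) (Ioo a b) := by
      intro c
      simp_rw [hQval]
      refine continuousOn_finsetSum _ fun i hi => continuousOn_const.mul ?_
      exact (hg.contDiffOn_div (i := i) (j := 0) (by simpa using hi) (by omega)).continuousOn
    have hder : ∀ c : ℕ → ℝ, ∀ t ∈ Ioo a b, HasDerivAt
        (fun t => (∑ i ∈ Finset.range (k + 1), c i * g i t) / g 0 t)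
        (∑ i ∈ Finset.range k, c (i + 1) * deriv (fun t => g (i + 1) t / g 0 t) t) t := by
      intro c t ht
      have h1 : (fun t => (∑ i ∈ Finset.range (k + 1), c i * g i t) / g 0 t) =ᶠ[𝓝 t]
          fun t => (∑ i ∈ Finset.range k, c (i + 1) * (g (i + 1) t / g 0 t)) + c 0 := by
        filter_upwards [isOpen_Ioo.mem_nhds ht] with s hs
        rw [hQval, Finset.sum_range_succ', div_self (hpos s hs).ne', mul_one]
      refine HasDerivAt.congr_of_eventuallyEq ?_ h1
      refine (HasDerivAt.fun_sum fun i hi => HasDerivAt.const_mul _ ?_).add_const _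
      have hik : i < k := by simpa using hi
      exact (((hg.contDiffOn_div (i := i + 1) (j := 1) (by omega) (by omega)).contDiffAt
        (isOpen_Ioo.mem_nhds ht)).differentiableAt (by simp)).hasDerivAt
    refine ⟨fun c Z D hDZ hZ hD hk i hi => ?_, fun c Z hZ hk hc t ht hZt => ?_⟩
    · have h0 : ∀ i < k, c (i + 1) = 0 := by
        -- A system of length one is only assumed continuous, so derivatives are available for `0 <
        -- k` only.
        rcases Nat.eq_zero_or_pos k with rfl | hk0
        · intro i hi; omega
        refine hh.primitive_coeff_eq_zero (c := fun i => c (i + 1)) (S := Ioo a b) (Z := Z) (D := D)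
          ordConnected_Ioo Ioo_subset_Icc_self (hcont c) (hder c) hDZ
          (fun z hz => ⟨(hZ z hz).1, by simp [(hZ z hz).2]⟩) (fun z hz => ?_) hk
        have hzI := (hZ z (hDZ hz)).1
        refine ⟨hzI, ?_⟩
        have hP : DifferentiableAt ℝ (fun t => ∑ i ∈ Finset.range (k + 1), c i * g i t) z :=
          DifferentiableAt.fun_sum fun i hi =>
            (hdiff hk0 i (by simpa using hi) z hzI).const_mul _
        rw [deriv_fun_div hP (hdiff hk0 0 (by omega) z hzI) (hpos z hzI).ne', hD z hz,
          (hZ z (hDZ hz)).2]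
        simp
      -- With the higher coefficients gone, the combination is `c 0 * g 0`, and `g 0` is positive at
      -- a zero `z`.
      rcases i with _ | i
      · have hne : Z.Nonempty := by
          rw [Finset.nonempty_iff_ne_empty]
          rintro rfl
          simp [Finset.subset_empty.1 hDZ] at hk
        obtain ⟨z, hz⟩ := hne
        have := (hZ z hz).2
        rw [Finset.sum_range_succ', Finset.sum_eq_zero fun i hi => by
          rw [h0 i (by simpa using hi), zero_mul], zero_add] at this
        exact (mul_eq_zero.1 this).resolve_right (hpos z (hZ z hz).1).ne'
      · exact h0 i (by omega)
    · rcases Nat.eq_zero_or_pos k with rfl | hk0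
      · simpa using mul_pos hc (hpos t ht)
      have hne : Z.Nonempty := Finset.card_pos.1 (by omega)
      obtain ⟨Z', h1, h2, h3⟩ := hh.exists_strictMonoOn_primitive (c := fun i => c (i + 1))
        (S := Ioo a b) (Z := Z) (D := ∅)
        ordConnected_Ioo Ioo_subset_Icc_self (hcont c) (hder c) (by simp)
        (fun z hz => ⟨(hZ z hz).1, by simp [(hZ z hz).2]⟩) (by simp) (by simp; omega) hne
        (by simpa [Nat.sub_add_cancel hk0] using hc)
      have hxZ := Z.max'_mem hne
      have := h3 (Z.max' hne) (hZ _ hxZ).1 (fun z hz => by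
        obtain ⟨x, hx, hzx⟩ := h2 z hz
        exact hzx.trans (Z.le_max' x hx)) t ht (hZt _ hxZ)
      rw [(hZ _ hxZ).2, zero_div] at this
      exact (div_pos_iff_of_pos_right (hpos t ht)).1 this

/-! ### Hermite interpolation and touching combinations on the closed interval -/

/-- Functions `f₀, …, f_{k-1}` on `[a, b]` whose derivatives have positive Wronskians. -/
structure IsTorsionPositive (a b : ℝ) (k : ℕ) (f : ℕ → ℝ → ℝ) : Prop where
  cont : ∀ i < k, ContinuousOn (f i) (Icc a b)
  smooth : ∀ i < k, ContDiffOn ℝ k (f i) (Ioo a b)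
  polya : IsPolyaSystem a b k (fun i => deriv (f i))

/-- The combination `c₀ + ∑_{i<k} cᵢ fᵢ`. -/
def genPoly (f : ℕ → ℝ → ℝ) (k : ℕ) (c₀ : ℝ) (c : ℕ → ℝ) (t : ℝ) : ℝ :=
  c₀ + ∑ i ∈ Finset.range k, c i * f i t

/-- The weight of a finite set of nodes: interior nodes count twice. -/
noncomputable def weight (a b : ℝ) (Z : Finset ℝ) : ℕ := by
  classical exact Z.card + (Z.filter (· ∈ Ioo a b)).card

namespace IsTorsionPositive

variable {a b : ℝ} {k : ℕ} {f : ℕ → ℝ → ℝ} {c₀ : ℝ} {c : ℕ → ℝ} {Z D : Finset ℝ}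

lemma mono (hf : IsTorsionPositive a b k f) {l : ℕ} (hl : l ≤ k) : IsTorsionPositive a b l f :=
  ⟨fun i hi => hf.cont i (hi.trans_le hl),
    fun i hi => (hf.smooth i (hi.trans_le hl)).of_le (by exact_mod_cast hl), hf.polya.mono hl⟩

lemma differentiableAt (hf : IsTorsionPositive a b k f) {i : ℕ} (hi : i < k) {t : ℝ}
    (ht : t ∈ Ioo a b) : DifferentiableAt ℝ (f i) t :=
  ((hf.smooth i hi).contDiffAt (isOpen_Ioo.mem_nhds ht)).differentiableAt
    (by norm_cast; omega)

lemma continuousOn_genPoly (hf : IsTorsionPositive a b k f) :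
    ContinuousOn (genPoly f k c₀ c) (Icc a b) :=
  continuousOn_const.add (continuousOn_finsetSum _ fun i hi =>
    continuousOn_const.mul (hf.cont i (by simpa using hi)))

lemma hasDerivAt_genPoly (hf : IsTorsionPositive a b k f) {t : ℝ} (ht : t ∈ Ioo a b) :
    HasDerivAt (genPoly f k c₀ c) (∑ i ∈ Finset.range k, c i * deriv (f i) t) t :=
  (HasDerivAt.fun_sum fun i hi =>
    (hf.differentiableAt (by simpa using hi) ht).hasDerivAt.const_mul _).const_add _

/-- Differentiation removes `c₀` and leaves a combination of the Pólya system of the derivatives;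
Rolle costs one zero, hence the bound `k + 1`. -/
lemma coeff_eq_zero (hf : IsTorsionPositive a b k f) (hDZ : D ⊆ Z)
    (hZ : ∀ z ∈ Z, z ∈ Icc a b ∧ genPoly f k c₀ c z = 0)
    (hD : ∀ z ∈ D, z ∈ Ioo a b ∧ ∑ i ∈ Finset.range k, c i * deriv (f i) z = 0)
    (hk : k + 1 ≤ Z.card + D.card) : c₀ = 0 ∧ ∀ i < k, c i = 0 := by
  have h := hf.polya.isChebyshev.primitive_coeff_eq_zero (c := c) ordConnected_Icc Subset.rfl
    (hf.continuousOn_genPoly (c₀ := c₀) (c := c)) (fun t ht => hf.hasDerivAt_genPoly ht) hDZ hZ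
    (fun z hz => ⟨(hD z hz).1, by rw [(hf.hasDerivAt_genPoly (hD z hz).1).deriv, (hD z hz).2]⟩) hk
  refine ⟨?_, h⟩
  have hne : Z.Nonempty := by
    rw [Finset.nonempty_iff_ne_empty]
    rintro rfl
    simp [Finset.subset_empty.1 hDZ] at hk
  obtain ⟨z, hz⟩ := hne
  have := (hZ z hz).2
  rwa [genPoly, Finset.sum_eq_zero fun i hi => by rw [h i (by simpa using hi), zero_mul],
    add_zero] at this

/-- Hermite interpolation with values at `Z` and derivatives at `D`. -/
lemma exists_interpolation (hf : IsTorsionPositive a b k f) (hDZ : D ⊆ Z)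
    (hZ : ∀ z ∈ Z, z ∈ Icc a b) (hD : ∀ z ∈ D, z ∈ Ioo a b) (hk : Z.card + D.card = k + 1)
    (u v : ℝ → ℝ) :
    ∃ (c₀ : ℝ) (c : ℕ → ℝ), (∀ z ∈ Z, genPoly f k c₀ c z = u z) ∧
      ∀ z ∈ D, ∑ i ∈ Finset.range k, c i * deriv (f i) z = v z := by
  let Φ : (ℝ × (Fin k → ℝ)) →ₗ[ℝ] ((Z → ℝ) × (D → ℝ)) :=
    { toFun := fun p => (fun z => p.1 + ∑ i : Fin k, p.2 i * f i z,
        fun z => ∑ i : Fin k, p.2 i * deriv (f i) z)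
      map_add' := fun p q => by
        ext z
        · simp only [Prod.fst_add, Prod.snd_add, Pi.add_apply, add_mul, Finset.sum_add_distrib]
          ring
        · simp only [Prod.snd_add, Pi.add_apply, add_mul, Finset.sum_add_distrib]
      map_smul' := fun r p => by
        ext z
        · simp only [Prod.smul_fst, Prod.smul_snd, Pi.smul_apply, smul_eq_mul, RingHom.id_apply,
            mul_add, Finset.mul_sum, mul_assoc]
        · simp only [Prod.smul_snd, Pi.smul_apply, smul_eq_mul, RingHom.id_apply,
            Finset.mul_sum, mul_assoc] }
  let ext : (Fin k → ℝ) → ℕ → ℝ := fun p i => if h : i < k then p ⟨i, h⟩ else 0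
  have hext : ∀ (p : Fin k → ℝ) (y : ℕ → ℝ),
      ∑ i ∈ Finset.range k, ext p i * y i = ∑ i : Fin k, p i * y i := by
    intro p y
    rw [Finset.sum_range]
    exact Finset.sum_congr rfl fun i _ => by simp [ext]
  have hinj : Function.Injective Φ := by
    rw [injective_iff_map_eq_zero]
    rintro ⟨p, q⟩ h
    have h1 := congrArg Prod.fst h
    have h2 := congrArg Prod.snd h
    obtain ⟨h3, h4⟩ := hf.coeff_eq_zero (c₀ := p) (c := ext q) hDZ
      (fun z hz => ⟨hZ z hz, by
        rw [genPoly, hext q (fun i => f i z)]; exact congrFun h1 ⟨z, hz⟩⟩)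
      (fun z hz => ⟨hD z hz, by
        rw [hext q (fun i => deriv (f i) z)]; exact congrFun h2 ⟨z, hz⟩⟩) hk.ge
    refine Prod.ext h3 (funext fun i => ?_)
    simpa [ext] using h4 i i.2
  -- The system is square because `Z.card + D.card = k + 1`, so uniqueness gives existence.
  have hsurj : Function.Surjective Φ :=
    (LinearMap.injective_iff_surjective_of_finrank_eq_finrank
      (by simp [hk, add_comm])).1 hinj
  obtain ⟨⟨p, q⟩, h⟩ := hsurj (fun z => u z, fun z => v z)
  have h1 := congrArg Prod.fst h
  have h2 := congrArg Prod.snd h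
  refine ⟨p, ext q, fun z hz => ?_, fun z hz => ?_⟩
  · rw [genPoly, hext q (fun i => f i z)]; exact congrFun h1 ⟨z, hz⟩
  · rw [hext q (fun i => deriv (f i) z)]; exact congrFun h2 ⟨z, hz⟩

lemma mem_of_genPoly_eq_zero (hf : IsTorsionPositive a b k f) (hDZ : D ⊆ Z)
    (hZ : ∀ z ∈ Z, z ∈ Icc a b ∧ genPoly f k c₀ c z = 0)
    (hD : ∀ z ∈ D, z ∈ Ioo a b ∧ ∑ i ∈ Finset.range k, c i * deriv (f i) z = 0)
    (hk : k = Z.card + D.card) (hc : ∃ i < k, c i ≠ 0) {t : ℝ} (ht : t ∈ Icc a b)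
    (h0 : genPoly f k c₀ c t = 0) : t ∈ Z := by
  classical
  by_contra h
  obtain ⟨i, hi, hci⟩ := hc
  refine hci ((hf.coeff_eq_zero (c₀ := c₀) (Z := insert t Z) (hDZ.trans (Finset.subset_insert _ _))
    (fun z hz => ?_) hD ?_).2 i hi)
  · rcases Finset.mem_insert.1 hz with rfl | hz
    exacts [⟨ht, h0⟩, hZ z hz]
  · rw [Finset.card_insert_of_notMem h]; omega

/-- All interior zeros are double and exhaust the zero count, so none has higher order: the second
derivative there is nonzero and the zero is a local extremum. -/
lemma eventually_sign (hf : IsTorsionPositive a b k f) (hDZ : D ⊆ Z)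
    (hZ : ∀ z ∈ Z, z ∈ Icc a b ∧ genPoly f k c₀ c z = 0)
    (hD : ∀ z ∈ D, z ∈ Ioo a b ∧ ∑ i ∈ Finset.range k, c i * deriv (f i) z = 0)
    (hZD : ∀ z ∈ Z, z ∈ Ioo a b → z ∈ D)
    (hk : k = Z.card + D.card) (hc : ∃ i < k, c i ≠ 0) {t : ℝ} (ht : t ∈ Ioo a b) :
    (∀ᶠ s in 𝓝 t, 0 ≤ genPoly f k c₀ c s) ∨ (∀ᶠ s in 𝓝 t, genPoly f k c₀ c s ≤ 0) := by
  have hcont : ContinuousAt (genPoly f k c₀ c) t := (hf.hasDerivAt_genPoly ht).continuousAt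
  by_cases h0 : genPoly f k c₀ c t = 0
  · have htZ := hf.mem_of_genPoly_eq_zero hDZ hZ hD hk hc (Ioo_subset_Icc_self ht) h0
    have htD := hZD t htZ ht
    have hd0 : deriv (genPoly f k c₀ c) t = 0 := by
      rw [(hf.hasDerivAt_genPoly ht).deriv, (hD t htD).2]
    have heq : deriv (genPoly f k c₀ c) =ᶠ[𝓝 t]
        fun s => ∑ i ∈ Finset.range k, c i * deriv (f i) s := by
      filter_upwards [isOpen_Ioo.mem_nhds ht] with s hs
      exact (hf.hasDerivAt_genPoly hs).deriv
    -- Rolle yields `k - 1` zeros of the derivative. If the second derivative vanished at `t`, then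
    -- `t` would add one more, as a double zero if it is already among them and as a new zero
    -- otherwise.
    have hd2 : deriv (deriv (genPoly f k c₀ c)) t ≠ 0 := by
      intro h2
      rw [heq.deriv_eq] at h2
      obtain ⟨Z', h1, h3, h4⟩ := exists_zeros_deriv ordConnected_Icc
        (hf.continuousOn_genPoly (c₀ := c₀) (c := c)) Z D hDZ hZ
        (fun z hz => by rw [(hf.hasDerivAt_genPoly (hD z hz).1).deriv, (hD z hz).2]) ⟨t, htZ⟩
      have h5 : ∀ z ∈ Z', z ∈ Ioo a b := by
        intro z hz
        rcases h4 z hz with h | ⟨x, hx, y, hy, hxz, hzy⟩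
        · exact (hD z h).1
        · exact ⟨(hZ x hx).1.1.trans_lt hxz, hzy.trans_le (hZ y hy).1.2⟩
      classical
      obtain ⟨i, hi, hci⟩ := hc
      by_cases htZ' : t ∈ Z'
      · refine hci (hf.polya.isChebyshev.1 c Z' {t} (by simpa using htZ')
          (fun z hz => ⟨h5 z hz, ?_⟩) (by simpa using h2) (by simp; omega) i hi)
        rw [← (hf.hasDerivAt_genPoly (c₀ := c₀) (h5 z hz)).deriv, h3 z hz]
      · refine hci (hf.polya.isChebyshev.1 c (insert t Z') ∅ (by simp)
          (fun z hz => ?_) (by simp) (by simp [htZ']; omega) i hi)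
        rcases Finset.mem_insert.1 hz with rfl | hz
        · exact ⟨ht, (hD _ htD).2⟩
        · exact ⟨h5 z hz, by rw [← (hf.hasDerivAt_genPoly (c₀ := c₀) (h5 z hz)).deriv, h3 z hz]⟩
    rcases lt_or_gt_of_ne hd2 with h | h
    · right
      filter_upwards [isLocalMax_of_deriv_deriv_neg h hd0 hcont] with s hs
      rwa [h0] at hs
    · left
      filter_upwards [isLocalMin_of_deriv_deriv_pos h hd0 hcont] with s hs
      rwa [h0] at hs
  · rcases lt_or_gt_of_ne h0 with h | h
    · exact Or.inr ((hcont.eventually_lt continuousAt_const h).mono fun _ h => h.le)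
    · exact Or.inl ((continuousAt_const.eventually_lt hcont h).mono fun _ h => h.le)

/-- The points with local sign `≥ 0` and those with local sign `≤ 0` form two open sets covering
`(a, b)`. If both are nonempty they meet by connectedness, and the combination vanishes near a
common point, against the finiteness of its zeros. -/
lemma sign_const (hf : IsTorsionPositive a b k f) (hab : a < b) (hDZ : D ⊆ Z)
    (hZ : ∀ z ∈ Z, z ∈ Icc a b ∧ genPoly f k c₀ c z = 0)
    (hD : ∀ z ∈ D, z ∈ Ioo a b ∧ ∑ i ∈ Finset.range k, c i * deriv (f i) z = 0)
    (hZD : ∀ z ∈ Z, z ∈ Ioo a b → z ∈ D)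
    (hk : k = Z.card + D.card) (hc : ∃ i < k, c i ≠ 0) :
    (∀ t ∈ Icc a b, 0 ≤ genPoly f k c₀ c t) ∨ (∀ t ∈ Icc a b, genPoly f k c₀ c t ≤ 0) := by
  have hcont : ContinuousOn (genPoly f k c₀ c) (closure (Ioo a b)) := by
    rw [closure_Ioo hab.ne]; exact hf.continuousOn_genPoly
  have hsign := fun t (ht : t ∈ Ioo a b) => hf.eventually_sign hDZ hZ hD hZD hk hc ht
  by_cases h1 : ∃ t ∈ Ioo a b, ∀ᶠ s in 𝓝 t, 0 ≤ genPoly f k c₀ c s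
  · by_cases h2 : ∃ t ∈ Ioo a b, ∀ᶠ s in 𝓝 t, genPoly f k c₀ c s ≤ 0
    · exfalso
      obtain ⟨x, hx, hx1, hx2⟩ := isPreconnected_Ioo (a := a) (b := b)
        {t | ∀ᶠ s in 𝓝 t, 0 ≤ genPoly f k c₀ c s} {t | ∀ᶠ s in 𝓝 t, genPoly f k c₀ c s ≤ 0}
        isOpen_setOfPred_eventually_nhds isOpen_setOfPred_eventually_nhds hsign h1 h2
      have : {s | s ∈ Z} ∈ 𝓝 x := by
        filter_upwards [hx1, hx2, isOpen_Ioo.mem_nhds hx] with s h3 h4 hs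
        exact hf.mem_of_genPoly_eq_zero hDZ hZ hD hk hc (Ioo_subset_Icc_self hs)
          (le_antisymm h4 h3)
      exact infinite_of_mem_nhds x this Z.finite_toSet
    · left
      intro t ht
      rw [← closure_Ioo hab.ne] at ht
      refine le_on_closure (fun s hs => ?_) continuousOn_const hcont ht
      exact ((hsign s hs).resolve_right (fun h => h2 ⟨s, hs, h⟩)).self_of_nhds
  · right
    intro t ht
    rw [← closure_Ioo hab.ne] at ht
    refine le_on_closure (fun s hs => ?_) hcont continuousOn_const ht
    exact ((hsign s hs).resolve_left (fun h => h1 ⟨s, hs, h⟩)).self_of_nhds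

/-- The constant sign is read off near `b`, where the combination strictly increases past the last
zero of its derivative: away from zero if `b` is not a node, up to zero if it is. -/
lemma sign_of_leading_pos (hf : IsTorsionPositive a b k f) (hab : a < b) (hDZ : D ⊆ Z)
    (hZ : ∀ z ∈ Z, z ∈ Icc a b ∧ genPoly f k c₀ c z = 0)
    (hD : ∀ z ∈ D, z ∈ Ioo a b ∧ ∑ i ∈ Finset.range k, c i * deriv (f i) z = 0)
    (hZD : ∀ z ∈ Z, z ∈ Ioo a b → z ∈ D)
    (hk : k = Z.card + D.card) (hk0 : 0 < k) (hc : 0 < c (k - 1)) :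
    (b ∉ Z → ∀ t ∈ Icc a b, 0 ≤ genPoly f k c₀ c t) ∧
    (b ∈ Z → ∀ t ∈ Icc a b, genPoly f k c₀ c t ≤ 0) := by
  have hconst := hf.sign_const hab hDZ hZ hD hZD hk ⟨k - 1, by omega, hc.ne'⟩
  have hne : Z.Nonempty := by
    rw [Finset.nonempty_iff_ne_empty]
    rintro rfl
    simp [Finset.subset_empty.1 hDZ] at hk
    omega
  obtain ⟨Z', h1, h2, h3⟩ := hf.polya.isChebyshev.exists_strictMonoOn_primitive (c := c)
    ordConnected_Icc Subset.rfl
    (hf.continuousOn_genPoly (c₀ := c₀) (c := c)) (fun t ht => hf.hasDerivAt_genPoly ht) hDZ hZ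
    (fun z hz => ⟨(hD z hz).1, by rw [(hf.hasDerivAt_genPoly (hD z hz).1).deriv, (hD z hz).2]⟩)
    hk hne hc
  have hbI : b ∈ Icc a b := right_mem_Icc.2 hab.le
  refine ⟨fun hb => hconst.resolve_right fun hneg => ?_,
    fun hb => hconst.resolve_left fun hpos => ?_⟩
  · have hm := Z.max'_mem hne
    have hlt : Z.max' hne < b := lt_of_le_of_ne (hZ _ hm).1.2 fun h => hb (h ▸ hm)
    have := h3 _ (hZ _ hm).1 (fun z hz => by
      obtain ⟨x, hx, hzx⟩ := h2 z hz
      exact hzx.trans (Z.le_max' x hx)) b hbI hlt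
    rw [(hZ _ hm).2] at this
    exact absurd (hneg b hbI) (not_le.2 this)
  · classical
    -- The midpoint only guarantees a point of `(a, b)` when `Z'` is empty.
    have hne' : (insert ((a + b) / 2) Z').Nonempty := Finset.insert_nonempty _ _
    have hm : (insert ((a + b) / 2) Z').max' hne' ∈ Ioo a b := by
      rcases Finset.mem_insert.1 ((insert ((a + b) / 2) Z').max'_mem hne') with h | h
      · rw [h]; constructor <;> linarith
      · exact h1 _ h
    have := h3 _ (Ioo_subset_Icc_self hm)
      (fun z hz => Finset.le_max' _ _ (Finset.mem_insert_of_mem hz)) b hbI hm.2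
    rw [(hZ b hb).2] at this
    exact absurd (hpos _ (Ioo_subset_Icc_self hm)) (not_le.2 this)

/-- For nodes of weight `k + 1`, some combination with leading term `f_k` vanishes exactly at the
nodes and has a constant sign, determined by whether `b` is a node. -/
lemma exists_touching (hf : IsTorsionPositive a b (k + 1) f) (hab : a < b)
    (hZ : ∀ z ∈ Z, z ∈ Icc a b) (hk : weight a b Z = k + 1) :
    ∃ (c₀ : ℝ) (c : ℕ → ℝ),
      (∀ t ∈ Icc a b, f k t = genPoly f k c₀ c t ↔ t ∈ Z) ∧
      (b ∉ Z → ∀ t ∈ Icc a b, genPoly f k c₀ c t ≤ f k t) ∧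
      (b ∈ Z → ∀ t ∈ Icc a b, f k t ≤ genPoly f k c₀ c t) := by
  classical
  set D := Z.filter (· ∈ Ioo a b) with hDdef
  have hDZ : D ⊆ Z := Finset.filter_subset _ _
  have hDI : ∀ z ∈ D, z ∈ Ioo a b := fun z hz => (Finset.mem_filter.1 hz).2
  have hkc : Z.card + D.card = k + 1 := by rw [← hk, weight]
  obtain ⟨c₀, c, h1, h2⟩ := (hf.mono k.le_succ).exists_interpolation hDZ hZ hDI hkc
    (f k) (deriv (f k))
  -- Coefficients of `f k` minus its Hermite interpolant; the leading one is `1`.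
  let c' : ℕ → ℝ := fun i => if i = k then 1 else - c i
  have hsum : ∀ y : ℕ → ℝ, ∑ i ∈ Finset.range (k + 1), c' i * y i =
      y k - ∑ i ∈ Finset.range k, c i * y i := by
    intro y
    rw [Finset.sum_range_succ, show c' k = 1 by simp [c'], one_mul, add_comm, sub_eq_add_neg,
      ← Finset.sum_neg_distrib]
    congr 1
    refine Finset.sum_congr rfl fun i hi => ?_
    have : i ≠ k := (Finset.mem_range.1 hi).ne
    simp [c', this]
  have hgen : ∀ t, genPoly f (k + 1) (-c₀) c' t = f k t - genPoly f k c₀ c t := by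
    intro t
    rw [genPoly, hsum (fun i => f i t), genPoly]; ring
  have hZ' : ∀ z ∈ Z, z ∈ Icc a b ∧ genPoly f (k + 1) (-c₀) c' z = 0 :=
    fun z hz => ⟨hZ z hz, by rw [hgen, h1 z hz, sub_self]⟩
  have hD' : ∀ z ∈ D, z ∈ Ioo a b ∧ ∑ i ∈ Finset.range (k + 1), c' i * deriv (f i) z = 0 :=
    fun z hz => ⟨hDI z hz, by rw [hsum (fun i => deriv (f i) z), h2 z hz, sub_self]⟩
  have hc' : 0 < c' (k + 1 - 1) := by simp [c']
  obtain ⟨h3, h4⟩ := hf.sign_of_leading_pos hab hDZ hZ' hD'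
    (fun z hz hzI => Finset.mem_filter.2 ⟨hz, hzI⟩) hkc.symm k.succ_pos hc'
  refine ⟨c₀, c, fun t ht => ⟨fun h => ?_, fun h => (h1 t h).symm⟩, fun hb t ht => ?_,
    fun hb t ht => ?_⟩
  · refine hf.mem_of_genPoly_eq_zero hDZ hZ' hD' hkc.symm ⟨k, k.lt_succ_self, by simp [c']⟩ ht ?_
    rw [hgen, h, sub_self]
  · have := h3 hb t ht
    rw [hgen] at this; linarith
  · have := h4 hb t ht
    rw [hgen] at this; linarith

end IsTorsionPositive

/-! ### Affine functions along a curve with totally positive torsion -/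

/-- The coordinates of a curve in `ℝᵈ`, as a sequence of functions. -/
def coordSeq {d : ℕ} (γ : ℝ → Fin d → ℝ) (i : ℕ) (t : ℝ) : ℝ :=
  if h : i < d then γ t ⟨i, h⟩ else 0

lemma iteratedDeriv_apply_of_contDiffOn {d m : ℕ} {γ : ℝ → Fin d → ℝ} {s : Set ℝ} (hs : IsOpen s)
    (hγ : ContDiffOn ℝ m γ s) (i : Fin d) :
    ∀ j ≤ m, ∀ t ∈ s, iteratedDeriv j γ t i = iteratedDeriv j (fun t => γ t i) t := by
  intro j
  induction j with
  | zero => simp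
  | succ j ih =>
    intro hj t ht
    have hd : DifferentiableAt ℝ (iteratedDeriv j γ) t := by
      have h1 := (hγ.differentiableOn_iteratedDerivWithin (m := j) (by exact_mod_cast hj)
        hs.uniqueDiffOn t ht).differentiableAt (hs.mem_nhds ht)
      refine h1.congr_of_eventuallyEq ?_
      filter_upwards [hs.mem_nhds ht] with x hx
      exact (iteratedDerivWithin_of_isOpen hs hx).symm
    have heq : iteratedDeriv j (fun t => γ t i) =ᶠ[𝓝 t] fun t => iteratedDeriv j γ t i := by
      filter_upwards [hs.mem_nhds ht] with x hx
      exact (ih (by omega) x hx).symm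
    rw [iteratedDeriv_succ, iteratedDeriv_succ, heq.deriv_eq]
    exact (hasDerivAt_pi.1 hd.hasDerivAt i).deriv.symm

lemma TotallyPositiveTorsion.isTorsionPositive {d : ℕ} {γ : ℝ → Fin d → ℝ} {a b : ℝ}
    (htor : TotallyPositiveTorsion γ a b) (hγ : ContinuousOn γ (Icc a b))
    (hγ' : ContDiffOn ℝ d γ (Ioo a b)) : IsTorsionPositive a b d (coordSeq γ) := by
  have hco : ∀ i (hi : i < d), coordSeq γ i = fun t => γ t ⟨i, hi⟩ := by
    intro i hi; funext t; simp [coordSeq, hi]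
  have hsm : ∀ i < d, ContDiffOn ℝ d (coordSeq γ i) (Ioo a b) := by
    intro i hi
    rw [hco i hi]
    exact contDiffOn_pi.1 hγ' ⟨i, hi⟩
  refine ⟨fun i hi => ?_, hsm, ⟨fun i hi j hj => ?_, fun j hj t ht => ?_⟩⟩
  · rw [hco i hi]
    exact continuousOn_pi.1 hγ ⟨i, hi⟩
  · exact (hsm i hi).deriv_of_isOpen isOpen_Ioo (by exact_mod_cast hj)
  · convert htor t ht j hj using 1
    unfold wronskian
    congr 1
    ext i l
    have hi : (i : ℕ) < d := i.2.trans_le hj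
    simp only [Matrix.of_apply]
    rw [iteratedDeriv_apply_of_contDiffOn isOpen_Ioo hγ' _ _ (by omega) t ht,
      ← iteratedDeriv_succ', hco i hi]
    rfl

/-- The projection to the first `n` coordinates as a linear map. -/
def barL (n : ℕ) : (Fin (n + 1) → ℝ) →ₗ[ℝ] (Fin n → ℝ) where
  toFun := bar
  map_add' _ _ := rfl
  map_smul' _ _ := rfl

/-- The last coordinate as a linear map. -/
def zcL (n : ℕ) : (Fin (n + 1) → ℝ) →ₗ[ℝ] ℝ where
  toFun := zc
  map_add' _ _ := rfl
  map_smul' _ _ := rfl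

/-- Continuous curves in `ℝⁿ⁺¹` with totally positive torsion. -/
structure IsTorsionCurve (n : ℕ) (a b : ℝ) (γ : ℝ → Fin (n + 1) → ℝ) : Prop where
  lt : a < b
  cont : ContinuousOn γ (Icc a b)
  smooth : ContDiffOn ℝ (n + 1 : ℕ) γ (Ioo a b)
  tors : IsTorsionPositive a b (n + 1) (coordSeq γ)

namespace IsTorsionCurve

variable {n : ℕ} {a b : ℝ} {γ : ℝ → Fin (n + 1) → ℝ} {Z D : Finset ℝ}

/-- The linear functional with given coefficients. -/
noncomputable def functional (n : ℕ) (c : ℕ → ℝ) : (Fin n → ℝ) →L[ℝ] ℝ :=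
  ∑ i : Fin n, c i • ContinuousLinearMap.proj (R := ℝ) (φ := fun _ : Fin n => ℝ) i

lemma functional_apply (c : ℕ → ℝ) (y : Fin n → ℝ) : functional n c y = ∑ i : Fin n, c i * y i := by
  simp [functional]

lemma genPoly_eq (c₀ : ℝ) (c : ℕ → ℝ) (t : ℝ) :
    genPoly (coordSeq γ) n c₀ c t = c₀ + functional n c (bar (γ t)) := by
  rw [genPoly, functional_apply, Finset.sum_range]
  congr 1
  refine Finset.sum_congr rfl fun i _ => ?_
  have : (i : ℕ) < n + 1 := by omega
  simp only [coordSeq, this, dif_pos]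
  rfl

lemma contDiffOn_bar (h : IsTorsionCurve n a b γ) :
    ContDiffOn ℝ (n + 1 : ℕ) (fun t => bar (γ t)) (Ioo a b) :=
  contDiffOn_pi.2 fun i => contDiffOn_pi.1 h.smooth i.castSucc

lemma differentiableAt_bar (h : IsTorsionCurve n a b γ) {t : ℝ} (ht : t ∈ Ioo a b) :
    DifferentiableAt ℝ (fun t => bar (γ t)) t :=
  (h.contDiffOn_bar.contDiffAt (isOpen_Ioo.mem_nhds ht)).differentiableAt (by norm_cast)

lemma functional_deriv_bar (h : IsTorsionCurve n a b γ) (c : ℕ → ℝ) {t : ℝ} (ht : t ∈ Ioo a b) :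
    functional n c (deriv (fun t => bar (γ t)) t) =
      ∑ i ∈ Finset.range n, c i * deriv (coordSeq γ i) t := by
  rw [functional_apply, Finset.sum_range]
  refine Finset.sum_congr rfl fun i _ => ?_
  have hi : (i : ℕ) < n + 1 := by omega
  congr 1
  rw [← (hasDerivAt_pi.1 (h.differentiableAt_bar ht).hasDerivAt i).deriv]
  congr 1
  funext s
  simp only [coordSeq, hi, dif_pos]
  rfl

lemma exists_functional_eq (φ : (Fin n → ℝ) →L[ℝ] ℝ) : ∃ c : ℕ → ℝ, φ = functional n c := by
  refine ⟨fun i => if h : i < n then φ (Pi.single ⟨i, h⟩ 1) else 0, ?_⟩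
  ext y
  rw [functional_apply]
  conv_lhs => rw [pi_eq_sum_univ' y, map_sum]
  refine Finset.sum_congr rfl fun i _ => ?_
  rw [map_smul, smul_eq_mul, mul_comm]
  simp only [Fin.is_lt, dif_pos, Fin.eta]

/-- A nontrivial affine functional vanishes on the curve at most `n` times. -/
lemma functional_eq_zero (h : IsTorsionCurve n a b γ) {c₀ : ℝ} {φ : (Fin n → ℝ) →L[ℝ] ℝ}
    (hDZ : D ⊆ Z) (hZ : ∀ z ∈ Z, z ∈ Icc a b ∧ c₀ + φ (bar (γ z)) = 0)
    (hD : ∀ z ∈ D, z ∈ Ioo a b ∧ φ (deriv (fun t => bar (γ t)) z) = 0)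
    (hk : n + 1 ≤ Z.card + D.card) : φ = 0 := by
  obtain ⟨c, rfl⟩ := exists_functional_eq φ
  have := ((h.tors.mono n.le_succ).coeff_eq_zero (c₀ := c₀) (c := c) hDZ
    (fun z hz => ⟨(hZ z hz).1, by rw [genPoly_eq, (hZ z hz).2]⟩)
    (fun z hz => ⟨(hD z hz).1, by
      rw [← h.functional_deriv_bar c (hD z hz).1, (hD z hz).2]⟩) hk).2
  ext y
  rw [functional_apply]
  exact Finset.sum_eq_zero fun i _ => by rw [this i i.2, zero_mul]

/-- A nonnegative function has a minimum at each zero, so interior zeros are double. -/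
lemma weight_le (h : IsTorsionCurve n a b γ) {c₀ : ℝ} {φ : (Fin n → ℝ) →L[ℝ] ℝ} (hφ : φ ≠ 0)
    (hnn : ∀ t ∈ Icc a b, 0 ≤ c₀ + φ (bar (γ t)))
    (hZ : ∀ z ∈ Z, z ∈ Icc a b ∧ c₀ + φ (bar (γ z)) = 0) : weight a b Z ≤ n := by
  classical
  by_contra hlt
  refine hφ (h.functional_eq_zero (D := Z.filter (· ∈ Ioo a b)) (Finset.filter_subset _ _) hZ
    (fun z hz => ?_) (by rw [weight] at hlt; push Not at hlt; exact hlt))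
  obtain ⟨hzZ, hzI⟩ := Finset.mem_filter.1 hz
  refine ⟨hzI, ?_⟩
  have hd : HasDerivAt (fun t => c₀ + φ (bar (γ t))) (φ (deriv (fun t => bar (γ t)) z)) z :=
    (φ.hasFDerivAt.comp_hasDerivAt z (h.differentiableAt_bar hzI).hasDerivAt).const_add _
  refine IsLocalMin.hasDerivAt_eq_zero (f := fun t => c₀ + φ (bar (γ t))) ?_ hd
  filter_upwards [isOpen_Ioo.mem_nhds hzI] with s hs
  rw [(hZ z hzZ).2]
  exact hnn s (Ioo_subset_Icc_self hs)

/-- Hermite interpolation on the curve. -/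
lemma exists_interpolation (h : IsTorsionCurve n a b γ) (hDZ : D ⊆ Z)
    (hZ : ∀ z ∈ Z, z ∈ Icc a b) (hD : ∀ z ∈ D, z ∈ Ioo a b) (hk : Z.card + D.card ≤ n + 1)
    (u v : ℝ → ℝ) :
    ∃ (c₀ : ℝ) (φ : (Fin n → ℝ) →L[ℝ] ℝ), (∀ z ∈ Z, c₀ + φ (bar (γ z)) = u z) ∧
      ∀ z ∈ D, φ (deriv (fun t => bar (γ t)) z) = v z := by
  classical
  -- Extra simple nodes, with arbitrary data, fill the count up to exactly `n + 1`.
  have hinf : (Icc a b \ (Z : Set ℝ)).Infinite := (Icc_infinite h.lt).sdiff Z.finite_toSet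
  obtain ⟨Y, hY, hYc⟩ := hinf.exists_subset_card_eq (n + 1 - (Z.card + D.card))
  have hdis : Disjoint Z Y := Finset.disjoint_right.2 fun y hy => (hY hy).2
  obtain ⟨c₀, c, h1, h2⟩ := (h.tors.mono n.le_succ).exists_interpolation (Z := Z ∪ Y) (D := D)
    (hDZ.trans Finset.subset_union_left)
    (fun z hz => (Finset.mem_union.1 hz).elim (hZ z) fun hy => (hY hy).1) hD
    (by rw [Finset.card_union_of_disjoint hdis]; omega) u v
  refine ⟨c₀, functional n c, fun z hz => ?_, fun z hz => ?_⟩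
  · rw [← genPoly_eq, h1 z (Finset.mem_union_left _ hz)]
  · rw [h.functional_deriv_bar c (hD z hz), h2 z hz]

lemma exists_touching (h : IsTorsionCurve n a b γ) (hZ : ∀ z ∈ Z, z ∈ Icc a b)
    (hw : weight a b Z = n + 1) :
    ∃ (c₀ : ℝ) (φ : (Fin n → ℝ) →L[ℝ] ℝ),
      (∀ t ∈ Icc a b, zc (γ t) = c₀ + φ (bar (γ t)) ↔ t ∈ Z) ∧
      (b ∉ Z → ∀ t ∈ Icc a b, c₀ + φ (bar (γ t)) ≤ zc (γ t)) ∧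
      (b ∈ Z → ∀ t ∈ Icc a b, zc (γ t) ≤ c₀ + φ (bar (γ t))) := by
  obtain ⟨c₀, c, h1, h2, h3⟩ := h.tors.exists_touching h.lt hZ hw
  have hz : ∀ t, coordSeq γ n t = zc (γ t) := by
    intro t; simp [coordSeq, zc, Fin.last]
  simp only [genPoly_eq, hz] at h1 h2 h3
  exact ⟨c₀, functional n c, h1, h2, h3⟩

/-- Nodes of weight at most `n` lie on a supporting hyperplane of the projected curve. -/
lemma exists_supporting (h : IsTorsionCurve n a b γ) (hZ : ∀ z ∈ Z, z ∈ Icc a b)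
    (hne : Z.Nonempty) (hw : weight a b Z ≤ n) :
    ∃ (c₀ : ℝ) (φ : (Fin n → ℝ) →L[ℝ] ℝ), φ ≠ 0 ∧
      (∀ t ∈ Icc a b, 0 ≤ c₀ + φ (bar (γ t))) ∧ ∀ z ∈ Z, c₀ + φ (bar (γ z)) = 0 := by
  have hpos : 0 < weight a b Z := by
    rw [weight]
    have := hne.card_pos
    omega
  obtain ⟨k, hk⟩ : ∃ k, weight a b Z = k + 1 := ⟨weight a b Z - 1, by omega⟩
  have hkn : k < n := by omega
  -- For nodes of weight `k + 1 ≤ n` the touching combination of the first `k + 1` coordinates alone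
  -- already supports the projected curve; no nodes need to be added.
  obtain ⟨c₀, c, h1, h2, h3⟩ :=
    (h.tors.mono (l := k + 1) (by omega)).exists_touching h.lt hZ hk
  let c' : ℕ → ℝ := fun i => if i < k then - c i else if i = k then 1 else 0
  have hval : ∀ t, coordSeq γ k t - genPoly (coordSeq γ) k c₀ c t =
      -c₀ + functional n c' (bar (γ t)) := by
    intro t
    have hlow : ∑ i ∈ Finset.range k, c' i * coordSeq γ i t =
        -∑ i ∈ Finset.range k, c i * coordSeq γ i t := by
      rw [← Finset.sum_neg_distrib]
      exact Finset.sum_congr rfl fun i hi => by simp only [c', Finset.mem_range.1 hi, if_true]; ring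
    rw [← genPoly_eq, genPoly, genPoly, ← Finset.sum_subset
      (Finset.range_subset_range.2 (Nat.succ_le_of_lt hkn)), Finset.sum_range_succ, hlow,
      show c' k = 1 by simp [c']]
    · ring
    · intro i _ hi
      have h4 : ¬ i < k := fun h => hi (Finset.mem_range.2 (by omega))
      have h5 : i ≠ k := fun h => hi (Finset.mem_range.2 (by omega))
      simp [c', h4, h5]
  have hne0 : functional n c' ≠ 0 := by
    intro h0
    have := functional_apply (n := n) c' (Pi.single ⟨k, hkn⟩ 1)
    rw [h0, Finset.sum_eq_single ⟨k, hkn⟩] at this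
    · simp [c'] at this
    · intro j _ hj
      simp [hj]
    · simp
  have hzero : ∀ z ∈ Z, -c₀ + functional n c' (bar (γ z)) = 0 := fun z hz => by
    rw [← hval, (h1 z (hZ z hz)).2 hz, sub_self]
  by_cases hb : b ∈ Z
  · refine ⟨c₀, -functional n c', neg_ne_zero.2 hne0, fun t ht => ?_, fun z hz => ?_⟩
    · have := h3 hb t ht
      have h4 := hval t
      rw [neg_apply]; linarith
    · have := hzero z hz
      rw [neg_apply]; linarith
  · refine ⟨-c₀, functional n c', hne0, fun t ht => ?_, hzero⟩
    have := h2 hb t ht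
    have h4 := hval t
    linarith

end IsTorsionCurve

/-! ### Supporting hyperplanes and faces of convex hulls -/

lemma affine_sum {E ι : Type*} [AddCommGroup E] [Module ℝ E] [Fintype ι] (c₀ : ℝ) (ψ : E →ₗ[ℝ] ℝ)
    (w : ι → ℝ) (z : ι → E) (hw : ∑ i, w i = 1) :
    c₀ + ψ (∑ i, w i • z i) = ∑ i, w i * (c₀ + ψ (z i)) := by
  simp only [map_sum, map_smul, smul_eq_mul, mul_add, Finset.sum_add_distrib, ← Finset.sum_mul, hw,
    one_mul]

lemma affine_nonneg_of_mem_convexHull {E : Type*} [AddCommGroup E] [Module ℝ E] {S : Set E}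
    {c₀ : ℝ} {ψ : E →ₗ[ℝ] ℝ} (hS : ∀ s ∈ S, 0 ≤ c₀ + ψ s) {v : E} (hv : v ∈ convexHull ℝ S) :
    0 ≤ c₀ + ψ v := by
  obtain ⟨ι, _, w, z, hw0, hw1, hz, rfl⟩ := mem_convexHull_iff_exists_fintype.1 hv
  rw [affine_sum _ _ _ _ hw1]
  exact Finset.sum_nonneg fun i _ => mul_nonneg (hw0 i) (hS _ (hz i))

/-- An affine function vanishing on a face of the generating set vanishes on the face of the
convex hull. -/
lemma affine_eq_zero_on_face {E : Type*} [AddCommGroup E] [Module ℝ E] {S : Set E} {c₀ d₀ : ℝ}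
    {ψ χ : E →ₗ[ℝ] ℝ} (hS : ∀ s ∈ S, 0 ≤ c₀ + ψ s)
    (hχ : ∀ s ∈ S, c₀ + ψ s = 0 → d₀ + χ s = 0) {v : E} (hv : v ∈ convexHull ℝ S)
    (hv0 : c₀ + ψ v = 0) : d₀ + χ v = 0 := by
  obtain ⟨ι, _, w, z, hw0, hw1, hz, rfl⟩ := mem_convexHull_iff_exists_fintype.1 hv
  rw [affine_sum _ _ _ _ hw1] at hv0 ⊢
  have h := (Finset.sum_eq_zero_iff_of_nonneg fun i _ =>
    mul_nonneg (hw0 i) (hS _ (hz i))).1 hv0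
  refine Finset.sum_eq_zero fun i hi => ?_
  rcases mul_eq_zero.1 (h i hi) with h1 | h1
  · rw [h1, zero_mul]
  · rw [hχ _ (hz i) h1, mul_zero]

/-- At an interior point `c₀ + φ` would have a local minimum, forcing its derivative `φ` to vanish.
-/
lemma notMem_interior_of_supporting {E : Type*} [NormedAddCommGroup E] [NormedSpace ℝ E]
    {K : Set E} {c₀ : ℝ} {φ : E →L[ℝ] ℝ} (hφ : φ ≠ 0) (hK : ∀ y ∈ K, 0 ≤ c₀ + φ y) {y : E}
    (hy : c₀ + φ y = 0) : y ∉ interior K := by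
  intro hi
  refine hφ (IsLocalMin.hasFDerivAt_eq_zero (f := fun y => c₀ + φ y) (a := y) ?_
    (φ.hasFDerivAt.const_add c₀))
  filter_upwards [mem_interior_iff_mem_nhds.1 hi] with x hx
  rw [hy]
  exact hK x hx

lemma exists_supporting_of_notMem_interior {E : Type*} [NormedAddCommGroup E] [NormedSpace ℝ E]
    {K : Set E} (hK : Convex ℝ K) (hne : (interior K).Nonempty) {y : E} (hy : y ∉ interior K) :
    ∃ (c₀ : ℝ) (φ : E →L[ℝ] ℝ), φ ≠ 0 ∧ (∀ x ∈ K, 0 ≤ c₀ + φ x) ∧ c₀ + φ y = 0 := by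
  obtain ⟨f, hf⟩ := geometric_hahn_banach_open_point hK.interior isOpen_interior hy
  refine ⟨f y, -f, fun h0 => ?_, fun x hx => ?_, by simp⟩
  · obtain ⟨x, hx⟩ := hne
    have h1 : f = 0 := neg_eq_zero.1 h0
    have := hf x hx
    simp [h1] at this
  · have hx' : x ∈ closure (interior K) := by
      rw [hK.closure_interior_eq_closure_of_nonempty_interior hne]
      exact subset_closure hx
    have := le_on_closure (fun z hz => (hf z hz).le) f.continuous.continuousOn
      continuousOn_const hx'
    simp only [neg_apply]; linarith

namespace IsTorsionCurve

variable {n : ℕ} {a b : ℝ} {γ : ℝ → Fin (n + 1) → ℝ}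

lemma bar_image_convexHull : bar '' convexHull ℝ (γ '' Icc a b) =
    convexHull ℝ ((fun t => bar (γ t)) '' Icc a b) := by
  have := (barL n).image_convexHull (γ '' Icc a b)
  rw [image_image] at this
  exact this

lemma bar_mem_convexHull {v : Fin (n + 1) → ℝ} (hv : v ∈ convexHull ℝ (γ '' Icc a b)) :
    bar v ∈ convexHull ℝ ((fun t => bar (γ t)) '' Icc a b) := by
  rw [← bar_image_convexHull]
  exact ⟨v, hv, rfl⟩

lemma supporting_on_hull {c₀ : ℝ} {φ : (Fin n → ℝ) →L[ℝ] ℝ}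
    (hφ : ∀ t ∈ Icc a b, 0 ≤ c₀ + φ (bar (γ t))) :
    ∀ y ∈ convexHull ℝ ((fun t => bar (γ t)) '' Icc a b), 0 ≤ c₀ + φ y := fun y hy =>
  affine_nonneg_of_mem_convexHull (ψ := (φ : (Fin n → ℝ) →ₗ[ℝ] ℝ))
    (by rintro _ ⟨t, ht, rfl⟩; exact hφ t ht) hy

/-- The convex hull of the curve has a single point above each boundary point of the convex hull
of the projected curve. -/
lemma fiber_unique (h : IsTorsionCurve n a b γ)
    (hne : (interior (convexHull ℝ ((fun t => bar (γ t)) '' Icc a b))).Nonempty)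
    {v v' : Fin (n + 1) → ℝ} (hv : v ∈ convexHull ℝ (γ '' Icc a b))
    (hv' : v' ∈ convexHull ℝ (γ '' Icc a b)) (hvv : bar v = bar v')
    (hint : bar v ∉ interior (convexHull ℝ ((fun t => bar (γ t)) '' Icc a b))) :
    zc v = zc v' := by
  classical
  obtain ⟨c₀, φ, hφ, hK, hy⟩ := exists_supporting_of_notMem_interior (convex_convexHull ℝ _) hne hint
  have hnn : ∀ t ∈ Icc a b, 0 ≤ c₀ + φ (bar (γ t)) := fun t ht =>
    hK _ (subset_convexHull ℝ _ ⟨t, ht, rfl⟩)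
  -- Any `n + 1` contact points would already have weight above `n`.
  have hfin : {t | t ∈ Icc a b ∧ c₀ + φ (bar (γ t)) = 0}.Finite := by
    by_contra hinf
    obtain ⟨Z, hZ, hZc⟩ := (show {t | t ∈ Icc a b ∧ c₀ + φ (bar (γ t)) = 0}.Infinite from
      hinf).exists_subset_card_eq (n + 1)
    have := h.weight_le (Z := Z) hφ hnn fun z hz => hZ hz
    rw [weight] at this
    omega
  have hmem : ∀ z ∈ hfin.toFinset, z ∈ Icc a b ∧ c₀ + φ (bar (γ z)) = 0 := fun z hz => by
    simpa using hz
  have hw := h.weight_le hφ hnn hmem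
  rw [weight] at hw
  -- Few enough contact points remain to interpolate the last coordinate there by an affine function
  -- of the projection; the identity then extends to the whole face.
  obtain ⟨d₀, χ, hχ, _⟩ := h.exists_interpolation (Z := hfin.toFinset) (D := ∅) (by simp)
    (fun z hz => (hmem z hz).1) (by simp) (by rw [Finset.card_empty]; omega) (fun t => zc (γ t)) 0
  have key : ∀ w ∈ convexHull ℝ (γ '' Icc a b), bar w = bar v → zc w = d₀ + χ (bar w) := by
    intro w hw hwv
    have := affine_eq_zero_on_face (c₀ := c₀) (d₀ := d₀)
      (ψ := (φ : (Fin n → ℝ) →ₗ[ℝ] ℝ) ∘ₗ barL n)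
      (χ := (χ : (Fin n → ℝ) →ₗ[ℝ] ℝ) ∘ₗ barL n - zcL n) (S := γ '' Icc a b)
      (by rintro _ ⟨t, ht, rfl⟩; exact hnn t ht)
      (by
        rintro _ ⟨t, ht, rfl⟩ h0
        have := hχ t (by simpa using ⟨ht, h0⟩)
        change d₀ + (χ (bar (γ t)) - zc (γ t)) = 0
        linarith) hw (by
        change c₀ + φ (bar w) = 0
        rw [hwv, hy])
    change d₀ + (χ (bar w) - zc w) = 0 at this
    linarith
  rw [key v hv rfl, key v' hv' hvv.symm, hvv]

end IsTorsionCurve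

/-! ### The common form of the four parametrizations -/

lemma weight_mono {a b : ℝ} {Y Z : Finset ℝ} (h : Y ⊆ Z) : weight a b Y ≤ weight a b Z := by
  classical
  unfold weight
  exact add_le_add (Finset.card_le_card h) (Finset.card_le_card (Finset.filter_subset_filter _ h))

/-- Coinciding nodes only lower the weight, so it is enough to count indices. -/
lemma weight_image_le {ι : Type*} [DecidableEq ι] {a b : ℝ} (J M : Finset ι) (T : ι → ℝ)
    (hM : ∀ i ∈ J, T i ∈ Ioo a b → i ∈ M) : weight a b (J.image T) ≤ J.card + M.card := by
  classical
  unfold weight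
  refine add_le_add Finset.card_image_le ?_
  rw [Finset.filter_image]
  exact Finset.card_image_le.trans (Finset.card_le_card fun i hi => by
    obtain ⟨h1, h2⟩ := Finset.mem_filter.1 hi
    exact hM i h1 h2)

/-- A parametrization `F p = ∑ᵢ Wᵢ(p) γ(Tᵢ(p))` by convex combinations of points of the curve, with
weights and nodes depending affinely on `p`; the nodes outside `mv` are fixed endpoints. The sign
`σ` tells whether the endpoint `b` is a node. -/
structure HullParam (n : ℕ) (a b : ℝ) (γ : ℝ → Fin (n + 1) → ℝ) {X : Type*} [NormedAddCommGroup X]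
    [NormedSpace ℝ X] (D : Set X) (F : X → Fin (n + 1) → ℝ) (N : ℕ) (mv : Finset (Fin N))
    (W T : X → Fin N → ℝ) (σ : ℝ) : Prop where
  finiteDimensional : FiniteDimensional ℝ X
  finrank : Module.finrank ℝ X = n
  W_affine : ∃ W' : X →ₗ[ℝ] (Fin N → ℝ), ∀ p, W p = W 0 + W' p
  T_affine : ∃ T' : X →ₗ[ℝ] (Fin N → ℝ), ∀ p, T p = T 0 + T' p
  inj : ∀ p q, W p = W q → T p = T q → p = q
  -- The weight of the nodes at an interior parameter: each node counts once, each moving one once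
  -- more.
  card : N + mv.card = n + 1
  sum_W : ∀ p, ∑ i, W p i = 1
  fixed : ∀ i ∉ mv, (∀ p, T p i = a) ∨ (∀ p, T p i = b)
  eq_sum : ∀ p, F p = ∑ i, W p i • γ (T p i)
  mem : ∀ p ∈ D, (∀ i, 0 ≤ W p i) ∧ (∀ i, T p i ∈ Icc a b) ∧ Monotone (T p)
  mem_interior : ∀ p, p ∈ interior D ↔
    (∀ i, 0 < W p i) ∧ (∀ i ∈ mv, T p i ∈ Ioo a b) ∧ StrictMono (T p)
  isCompact : IsCompact D
  interior_nonempty : (interior D).Nonempty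
  side : (σ = 1 ∧ ∀ p ∈ interior D, ∃ i, T p i = b) ∨
    (σ = -1 ∧ ∀ p ∈ interior D, ∀ i, T p i ≠ b)

namespace HullParam

variable {n : ℕ} {a b : ℝ} {γ : ℝ → Fin (n + 1) → ℝ} {X : Type*} [NormedAddCommGroup X]
    [NormedSpace ℝ X] {D : Set X} {F : X → Fin (n + 1) → ℝ} {N : ℕ} {mv : Finset (Fin N)}
    {W T : X → Fin N → ℝ} {σ : ℝ}

lemma mem_convexHull (P : HullParam n a b γ D F N mv W T σ) {p : X} (hp : p ∈ D) :
    F p ∈ convexHull ℝ (γ '' Icc a b) := by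
  obtain ⟨h1, h2, _⟩ := P.mem p hp
  rw [P.eq_sum]
  exact (convex_convexHull ℝ _).sum_mem (fun i _ => h1 i) (P.sum_W p)
    fun i _ => subset_convexHull ℝ _ ⟨_, h2 i, rfl⟩

lemma affine_apply (P : HullParam n a b γ D F N mv W T σ) (p : X) (c₀ : ℝ)
    (ψ : (Fin (n + 1) → ℝ) →ₗ[ℝ] ℝ) :
    c₀ + ψ (F p) = ∑ i, W p i * (c₀ + ψ (γ (T p i))) := by
  rw [P.eq_sum, affine_sum _ _ _ _ (P.sum_W p)]

lemma affine_bar_apply (P : HullParam n a b γ D F N mv W T σ) (p : X) (c₀ : ℝ)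
    (φ : (Fin n → ℝ) →L[ℝ] ℝ) :
    c₀ + φ (bar (F p)) = ∑ i, W p i * (c₀ + φ (bar (γ (T p i)))) :=
  P.affine_apply p c₀ ((φ : (Fin n → ℝ) →ₗ[ℝ] ℝ) ∘ₗ barL n)

/-- A parameter leaves the interior when a coefficient vanishes, a moving node reaches an endpoint
or two nodes collide. Each event costs at least one unit of the weight `n + 1`. -/
lemma exists_supporting_nodes (P : HullParam n a b γ D F N mv W T σ) {p : X} (hp : p ∈ D)
    (hp' : p ∉ interior D) :
    ∃ Z : Finset ℝ, (∀ z ∈ Z, z ∈ Icc a b) ∧ Z.Nonempty ∧ weight a b Z ≤ n ∧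
      ∀ i, W p i ≠ 0 → T p i ∈ Z := by
  classical
  obtain ⟨h1, h2, h3⟩ := P.mem p hp
  have hM : ∀ i, T p i ∈ Ioo a b → i ∈ mv := by
    intro i hi
    by_contra h
    rcases P.fixed i h with h | h
    · exact hi.1.ne' (h p)
    · exact hi.2.ne (h p)
  have hcard := P.card
  refine ⟨(Finset.univ.filter fun i => W p i ≠ 0).image (T p), ?_, ?_, ?_, ?_⟩
  · intro z hz
    obtain ⟨i, _, rfl⟩ := Finset.mem_image.1 hz
    exact h2 i
  · rw [Finset.image_nonempty]
    obtain ⟨i, _, hi⟩ := Finset.exists_ne_zero_of_sum_ne_zero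
      (show ∑ i, W p i ≠ 0 by rw [P.sum_W]; exact one_ne_zero)
    exact ⟨i, by simpa using hi⟩
  · have herase : ∀ i : Fin N, weight a b ((Finset.univ.erase i).image (T p)) ≤ n := by
      intro i
      refine (weight_image_le _ mv (T p) fun i _ => hM i).trans ?_
      rw [Finset.card_erase_of_mem (Finset.mem_univ i), Finset.card_univ, Fintype.card_fin]
      have := i.2
      omega
    rw [P.mem_interior] at hp'
    by_cases hW : ∃ i, W p i = 0
    · obtain ⟨i, hi⟩ := hW
      refine (weight_mono (Finset.image_subset_image fun j hj => ?_)).trans (herase i)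
      refine Finset.mem_erase.2 ⟨fun hji => ?_, Finset.mem_univ _⟩
      rw [hji] at hj
      simp [hi] at hj
    · refine (weight_mono (Finset.image_subset_image (Finset.filter_subset _ _))).trans ?_
      by_cases hT : Function.Injective (T p)
      · have : ∃ i ∈ mv, T p i ∉ Ioo a b := by
          by_contra hmv
          push Not at hW hmv
          exact hp' ⟨fun i => lt_of_le_of_ne (h1 i) (hW i).symm, hmv, h3.strictMono_of_injective hT⟩
        obtain ⟨i, himv, hi⟩ := this
        refine (weight_image_le _ (mv.erase i) (T p) fun j _ hj => ?_).trans ?_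
        · exact Finset.mem_erase.2 ⟨fun h => hi (h ▸ hj), hM j hj⟩
        · have := Finset.card_erase_add_one himv
          rw [Finset.card_univ, Fintype.card_fin]
          omega
      · obtain ⟨i, j, hij, hne⟩ : ∃ i j, T p i = T p j ∧ i ≠ j := by
          simpa [Function.Injective] using hT
        refine (weight_mono fun z hz => ?_).trans (herase i)
        obtain ⟨l, _, rfl⟩ := Finset.mem_image.1 hz
        by_cases hl : l = i
        · exact Finset.mem_image.2 ⟨j, by simp [hne.symm], by rw [hl, hij]⟩
        · exact Finset.mem_image.2 ⟨l, by simp [hl], rfl⟩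
  · intro i hi
    exact Finset.mem_image.2 ⟨i, by simpa using hi, rfl⟩

lemma bar_notMem_interior (P : HullParam n a b γ D F N mv W T σ) (h : IsTorsionCurve n a b γ)
    {p : X} (hp : p ∈ D) (hp' : p ∉ interior D) :
    bar (F p) ∉ interior (convexHull ℝ ((fun t => bar (γ t)) '' Icc a b)) := by
  obtain ⟨Z, h1, h2, h3, h4⟩ := P.exists_supporting_nodes hp hp'
  obtain ⟨c₀, φ, h5, h6, h7⟩ := h.exists_supporting h1 h2 h3
  refine notMem_interior_of_supporting h5 (IsTorsionCurve.supporting_on_hull h6) ?_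
  rw [P.affine_bar_apply]
  refine Finset.sum_eq_zero fun i _ => ?_
  by_cases hi : W p i = 0
  · rw [hi, zero_mul]
  · rw [h7 _ (h4 i hi), mul_zero]

lemma T_mem_Icc (P : HullParam n a b γ D F N mv W T σ) {p : X} (hp : p ∈ interior D) (i : Fin N) :
    T p i ∈ Icc a b :=
  (P.mem p (interior_subset hp)).2.1 i

open Classical in
lemma card_nodes (P : HullParam n a b γ D F N mv W T σ) {p : X} (hp : p ∈ interior D) :
    (Finset.univ.image (T p)).card + (mv.image (T p)).card = n + 1 := by
  have hinj := ((P.mem_interior p).1 hp).2.2.injective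
  rw [Finset.card_image_of_injective _ hinj, Finset.card_image_of_injective _ hinj,
    Finset.card_univ, Fintype.card_fin, P.card]

open Classical in
lemma weight_nodes (P : HullParam n a b γ D F N mv W T σ) {p : X} (hp : p ∈ interior D) :
    weight a b (Finset.univ.image (T p)) = n + 1 := by
  rw [← P.card_nodes hp, weight]
  congr 2
  ext z
  simp only [Finset.mem_filter, Finset.mem_image, Finset.mem_univ, true_and]
  constructor
  · rintro ⟨⟨i, rfl⟩, hi⟩
    refine ⟨i, ?_, rfl⟩
    by_contra h
    rcases P.fixed i h with h | h
    · exact hi.1.ne' (h p)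
    · exact hi.2.ne (h p)
  · rintro ⟨i, hi, rfl⟩
    exact ⟨⟨i, rfl⟩, ((P.mem_interior p).1 hp).2.1 i hi⟩

/-- `σ` records the side: the curve lies below the touching graph when `b` is a node and above it
otherwise. -/
lemma exists_touching (P : HullParam n a b γ D F N mv W T σ) (h : IsTorsionCurve n a b γ)
    {p : X} (hp : p ∈ interior D) :
    ∃ (c₀ : ℝ) (φ : (Fin n → ℝ) →L[ℝ] ℝ),
      (∀ t ∈ Icc a b, zc (γ t) = c₀ + φ (bar (γ t)) ↔ ∃ i, T p i = t) ∧
      (∀ t ∈ Icc a b, 0 ≤ σ * (c₀ + φ (bar (γ t)) - zc (γ t))) := by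
  classical
  obtain ⟨c₀, φ, h1, h2, h3⟩ := h.exists_touching (Z := Finset.univ.image (T p))
    (fun z hz => by obtain ⟨i, _, rfl⟩ := Finset.mem_image.1 hz; exact P.T_mem_Icc hp i)
    (P.weight_nodes hp)
  refine ⟨c₀, φ, fun t ht => by simpa using h1 t ht, fun t ht => ?_⟩
  rcases P.side with ⟨rfl, hs⟩ | ⟨rfl, hs⟩
  · have := h3 (by simpa using hs p hp) t ht
    linarith
  · have := h2 (by simpa using hs p hp) t ht
    linarith

/-- Over interior parameters, `F p` is extremal in its fibre. -/
lemma extremal_interior (P : HullParam n a b γ D F N mv W T σ) (h : IsTorsionCurve n a b γ)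
    {p : X} (hp : p ∈ interior D) {v : Fin (n + 1) → ℝ} (hv : v ∈ convexHull ℝ (γ '' Icc a b))
    (hvp : bar v = bar (F p)) : σ * zc v ≤ σ * zc (F p) := by
  obtain ⟨c₀, φ, h1, h2⟩ := P.exists_touching h hp
  have h3 : zc (F p) = c₀ + φ (bar (F p)) := by
    have := P.affine_apply p c₀ ((φ : (Fin n → ℝ) →ₗ[ℝ] ℝ) ∘ₗ barL n - zcL n)
    rw [Finset.sum_eq_zero] at this
    · change c₀ + (φ (bar (F p)) - zc (F p)) = 0 at this
      linarith
    · intro i _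
      have := (h1 (T p i) (P.T_mem_Icc hp i)).2 ⟨i, rfl⟩
      change W p i * (c₀ + (φ (bar (γ (T p i))) - zc (γ (T p i)))) = 0
      rw [this]; ring
  have h4 := affine_nonneg_of_mem_convexHull (c₀ := σ * c₀)
    (ψ := σ • ((φ : (Fin n → ℝ) →ₗ[ℝ] ℝ) ∘ₗ barL n - zcL n)) (S := γ '' Icc a b)
    (by
      rintro _ ⟨t, ht, rfl⟩
      have := h2 t ht
      change 0 ≤ σ * c₀ + σ * (φ (bar (γ t)) - zc (γ t))
      linarith) hv
  change 0 ≤ σ * c₀ + σ * (φ (bar v) - zc v) at h4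
  rw [h3, ← hvp]
  linarith

/-- Combinations of curve points that reach `F p` use only the nodes of `p`. -/
lemma nodes_subset (P : HullParam n a b γ D F N mv W T σ) (h : IsTorsionCurve n a b γ)
    {p : X} (hp : p ∈ interior D) {M : ℕ} {w s : Fin M → ℝ} (hw : ∀ i, 0 < w i)
    (hw1 : ∑ i, w i = 1) (hs : ∀ i, s i ∈ Icc a b) (heq : ∑ i, w i • γ (s i) = F p) (j : Fin M) :
    ∃ i, T p i = s j := by
  obtain ⟨c₀, φ, h1, h2⟩ := P.exists_touching h hp
  have hσ : σ ≠ 0 := by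
    rcases P.side with ⟨rfl, _⟩ | ⟨rfl, _⟩ <;> norm_num
  set χ := (φ : (Fin n → ℝ) →ₗ[ℝ] ℝ) ∘ₗ barL n - zcL n with hχ
  have h3 : c₀ + χ (F p) = 0 := by
    rw [P.affine_apply]
    refine Finset.sum_eq_zero fun i _ => ?_
    have := (h1 (T p i) (P.T_mem_Icc hp i)).2 ⟨i, rfl⟩
    change W p i * (c₀ + (φ (bar (γ (T p i))) - zc (γ (T p i)))) = 0
    rw [this]; ring
  rw [← heq, affine_sum _ _ _ _ hw1] at h3
  -- Multiplied by `σ`, all summands are nonnegative with sum zero, so each `s j` is a contact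
  -- point.
  have h4 : ∑ i, w i * (σ * (c₀ + χ (γ (s i)))) = 0 := by
    have : ∑ i, w i * (σ * (c₀ + χ (γ (s i)))) = σ * ∑ i, w i * (c₀ + χ (γ (s i))) := by
      rw [Finset.mul_sum]
      exact Finset.sum_congr rfl fun i _ => by ring
    rw [this, h3, mul_zero]
  have h5 := (Finset.sum_eq_zero_iff_of_nonneg fun i _ => mul_nonneg (hw i).le (by
    have := h2 (s i) (hs i)
    change 0 ≤ σ * (c₀ + (φ (bar (γ (s i))) - zc (γ (s i))))
    linarith)).1 h4 j (Finset.mem_univ j)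
  have h6 := (mul_eq_zero.1 ((mul_eq_zero.1 h5).resolve_left (hw j).ne')).resolve_left hσ
  change c₀ + (φ (bar (γ (s j))) - zc (γ (s j))) = 0 at h6
  exact (h1 (s j) (hs j)).1 (by linarith)

open Classical in
/-- The points of the curve at the nodes and its tangent vectors at the moving nodes are
affinely independent. -/
lemma relation_trivial (P : HullParam n a b γ D F N mv W T σ) (h : IsTorsionCurve n a b γ)
    {p : X} (hp : p ∈ interior D) {x y : Fin N → ℝ} (hx : ∑ i, x i = 0) (hy : ∀ i ∉ mv, y i = 0)
    (hrel : ∑ i, (x i • bar (γ (T p i)) + y i • deriv (fun t => bar (γ t)) (T p i)) = 0) :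
    x = 0 ∧ y = 0 := by
  have hinj := ((P.mem_interior p).1 hp).2.2.injective
  have hint := fun u v => h.exists_interpolation (Z := Finset.univ.image (T p))
    (D := mv.image (T p)) (Finset.image_subset_image (Finset.subset_univ _))
    (fun z hz => by obtain ⟨i, _, rfl⟩ := Finset.mem_image.1 hz; exact P.T_mem_Icc hp i)
    (fun z hz => by
      obtain ⟨i, hi, rfl⟩ := Finset.mem_image.1 hz
      exact ((P.mem_interior p).1 hp).2.1 i hi) (P.card_nodes hp).le u v
  -- Pairing the relation with an affine function, whose constant drops out because `x` sums to
  -- zero; Hermite data dual to one value or one derivative then isolate a single coefficient.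
  have hpair : ∀ (c₀ : ℝ) (φ : (Fin n → ℝ) →L[ℝ] ℝ),
      ∑ i, (x i * (c₀ + φ (bar (γ (T p i)))) +
        y i * φ (deriv (fun t => bar (γ t)) (T p i))) = 0 := by
    intro c₀ φ
    have := congrArg φ hrel
    simp only [map_sum, map_add, map_smul, smul_eq_mul, map_zero] at this
    rw [← this, ← sub_eq_zero, ← Finset.sum_sub_distrib, ← zero_mul c₀, ← hx, Finset.sum_mul]
    exact Finset.sum_congr rfl fun i _ => by ring
  constructor
  · funext j
    obtain ⟨c₀, φ, h1, h2⟩ := hint (fun t => if t = T p j then 1 else 0) 0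
    have := hpair c₀ φ
    rw [Finset.sum_eq_single j] at this
    · rw [h1 _ (Finset.mem_image_of_mem _ (Finset.mem_univ j))] at this
      by_cases hj : j ∈ mv
      · simpa [h2 _ (Finset.mem_image_of_mem _ hj)] using this
      · simpa [hy j hj] using this
    · intro i _ hij
      rw [h1 _ (Finset.mem_image_of_mem _ (Finset.mem_univ i)), if_neg (fun e => hij (hinj e))]
      by_cases hi : i ∈ mv
      · simp [h2 _ (Finset.mem_image_of_mem _ hi)]
      · simp [hy i hi]
    · simp
  · funext j
    by_cases hj : j ∈ mv
    swap
    · exact hy j hj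
    obtain ⟨c₀, φ, h1, h2⟩ := hint 0 (fun t => if t = T p j then 1 else 0)
    have := hpair c₀ φ
    rw [Finset.sum_eq_single j] at this
    · rw [h1 _ (Finset.mem_image_of_mem _ (Finset.mem_univ j)),
        h2 _ (Finset.mem_image_of_mem _ hj)] at this
      simpa using this
    · intro i _ hij
      rw [h1 _ (Finset.mem_image_of_mem _ (Finset.mem_univ i))]
      by_cases hi : i ∈ mv
      · rw [h2 _ (Finset.mem_image_of_mem _ hi), if_neg (fun e => hij (hinj e))]
        simp
      · simp [hy i hi]
    · simp

end HullParam

/-! ### Diffeomorphism onto the interior of the projected hull -/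

/-- A `C^r` map, `r ≥ 1`, that is injective on an open set and has invertible derivatives there is
a diffeomorphism onto its image. -/
lemma isDiffeoOn_of_bijOn {E G : Type*} [NormedAddCommGroup E] [NormedSpace ℝ E] [CompleteSpace E]
    [NormedAddCommGroup G] [NormedSpace ℝ G] {r : ℕ} (hr : r ≠ 0) {F : E → G} {s : Set E}
    {t : Set G} (hs : IsOpen s) (hF : BijOn F s t) (hsm : ∀ p ∈ s, ContDiffAt ℝ r F p)
    (hder : ∀ p ∈ s, ∃ e : E ≃L[ℝ] G, HasFDerivAt F (e : E →L[ℝ] G) p) :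
    IsDiffeoOn r F s t := by
  classical
  rcases s.eq_empty_or_nonempty with rfl | ⟨p₀, hp₀⟩
  · have ht : t = ∅ := by simpa using hF.image_eq.symm
    subst ht
    exact ⟨hF, fun p hp => absurd hp (notMem_empty p), fun _ => 0, ⟨fun p hp => absurd hp (notMem_empty p),
      fun p hp => absurd hp (notMem_empty p)⟩, fun p hp => absurd hp (notMem_empty p)⟩
  have : Nonempty E := ⟨p₀⟩
  have hinv : InvOn (Function.invFunOn F s) F s t := hF.invOn_invFunOn
  refine ⟨hF, fun p hp => (hsm p hp).contDiffWithinAt, Function.invFunOn F s, hinv, fun y hy => ?_⟩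
  obtain ⟨p, hp, rfl⟩ := hF.surjOn hy
  obtain ⟨e, he⟩ := hder p hp
  have hr' : (r : WithTop ℕ∞) ≠ 0 := by exact_mod_cast hr
  have hstrict := (hsm p hp).hasStrictFDerivAt' he hr'
  have hloc := (hsm p hp).to_localInverse he hr'
  refine ContDiffAt.contDiffWithinAt (hloc.congr_of_eventuallyEq ?_)
  have h1 : ∀ᶠ z in 𝓝 (F p), (hsm p hp).localInverse he hr' z ∈ s :=
    hstrict.localInverse_tendsto (hs.mem_nhds hp)
  filter_upwards [h1, hstrict.eventually_right_inverse] with z hz1 hz2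
  have h3 := hinv.1 hz1
  have h4 : F ((hsm p hp).localInverse he hr' z) = z := hz2
  rwa [h4] at h3

lemma contDiff_bar {n : ℕ} {r : WithTop ℕ∞} :
    ContDiff ℝ r (bar : (Fin (n + 1) → ℝ) → Fin n → ℝ) :=
  contDiff_pi.2 fun i => contDiff_apply ℝ ℝ i.castSucc

lemma contDiff_zc {n : ℕ} {r : WithTop ℕ∞} : ContDiff ℝ r (zc : (Fin (n + 1) → ℝ) → ℝ) :=
  contDiff_apply ℝ ℝ (Fin.last n)

namespace HullParam

variable {n : ℕ} {a b : ℝ} {γ : ℝ → Fin (n + 1) → ℝ} {X : Type*} [NormedAddCommGroup X]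
    [NormedSpace ℝ X] {D : Set X} {F : X → Fin (n + 1) → ℝ} {N : ℕ} {mv : Finset (Fin N)}
    {W T : X → Fin N → ℝ} {σ : ℝ}

lemma bar_eq_sum (P : HullParam n a b γ D F N mv W T σ) (p : X) :
    bar (F p) = ∑ i, W p i • bar (γ (T p i)) :=
  (congrArg (barL n) (P.eq_sum p)).trans (by rw [map_sum]; rfl)

lemma zc_eq_sum (P : HullParam n a b γ D F N mv W T σ) (p : X) :
    zc (F p) = ∑ i, W p i * zc (γ (T p i)) :=
  (congrArg (zcL n) (P.eq_sum p)).trans (by rw [map_sum]; rfl)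

lemma contDiff_W (P : HullParam n a b γ D F N mv W T σ) {r : WithTop ℕ∞} : ContDiff ℝ r W := by
  have := P.finiteDimensional
  obtain ⟨W', hW⟩ := P.W_affine
  rw [funext hW]
  exact contDiff_const.add (LinearMap.toContinuousLinearMap W').contDiff

lemma contDiff_T (P : HullParam n a b γ D F N mv W T σ) {r : WithTop ℕ∞} : ContDiff ℝ r T := by
  have := P.finiteDimensional
  obtain ⟨T', hT⟩ := P.T_affine
  rw [funext hT]
  exact contDiff_const.add (LinearMap.toContinuousLinearMap T').contDiff

lemma continuousOn (P : HullParam n a b γ D F N mv W T σ) (h : IsTorsionCurve n a b γ) :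
    ContinuousOn F D := by
  rw [funext P.eq_sum]
  refine continuousOn_finsetSum _ fun i _ => ContinuousOn.fun_smul ?_ ?_
  · exact ((continuous_apply i).comp (P.contDiff_W (r := 0)).continuous).continuousOn
  · exact h.cont.comp ((continuous_apply i).comp (P.contDiff_T (r := 0)).continuous).continuousOn
      fun p hp => (P.mem p hp).2.1 i

lemma contDiffAt (P : HullParam n a b γ D F N mv W T σ) (h : IsTorsionCurve n a b γ) {p : X}
    (hp : p ∈ interior D) : ContDiffAt ℝ (n + 1 : ℕ) F p := by
  rw [funext P.eq_sum]
  refine ContDiffAt.sum fun i _ => ContDiffAt.fun_smul ?_ ?_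
  · exact (contDiff_pi.1 P.contDiff_W i).contDiffAt
  · by_cases hi : i ∈ mv
    · exact ContDiffAt.comp p (h.smooth.contDiffAt (isOpen_Ioo.mem_nhds
        (((P.mem_interior p).1 hp).2.1 i hi))) (contDiff_pi.1 P.contDiff_T i).contDiffAt
    · rcases P.fixed i hi with h1 | h1
      · simp only [h1]; exact contDiffAt_const
      · simp only [h1]; exact contDiffAt_const

lemma contDiffAt_bar (P : HullParam n a b γ D F N mv W T σ) (h : IsTorsionCurve n a b γ) {p : X}
    (hp : p ∈ interior D) : ContDiffAt ℝ (n + 1 : ℕ) (fun p => bar (F p)) p :=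
  contDiff_bar.contDiffAt.comp p (P.contDiffAt h hp)

/-- A kernel vector gives a linear relation between node points and tangents at moving nodes. Its
trivality stops all weights and nodes, as the weights are positive. -/
lemma fderiv_bar_injective (P : HullParam n a b γ D F N mv W T σ) (h : IsTorsionCurve n a b γ)
    {p : X} (hp : p ∈ interior D) :
    Function.Injective (fderiv ℝ (fun p => bar (F p)) p) := by
  rw [injective_iff_map_eq_zero]
  intro v hv
  obtain ⟨W', hW⟩ := P.W_affine
  obtain ⟨T', hT⟩ := P.T_affine
  have hline : HasDerivAt (fun s : ℝ => p + s • v) v 0 := by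
    simpa using ((hasDerivAt_id (0 : ℝ)).smul_const v).const_add p
  have hd1 : HasDerivAt (fun s : ℝ => bar (F (p + s • v))) 0 0 := by
    have hF : HasFDerivAt (fun p => bar (F p)) (fderiv ℝ (fun p => bar (F p)) p)
        (p + (0 : ℝ) • v) := by
      rw [zero_smul, add_zero]
      exact ((P.contDiffAt_bar h hp).differentiableAt (by norm_cast)).hasFDerivAt
    have := hF.comp_hasDerivAt (0 : ℝ) hline
    rwa [hv] at this
  have hWl : ∀ i (s : ℝ), W (p + s • v) i = W p i + s * W' v i := by
    intro i s
    rw [hW (p + s • v), hW p, map_add, map_smul]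
    simp [add_assoc]
  have hTl : ∀ i (s : ℝ), T (p + s • v) i = T p i + s * T' v i := by
    intro i s
    rw [hT (p + s • v), hT p, map_add, map_smul]
    simp [add_assoc]
  -- Fixed nodes do not move, so differentiability of `γ` at the endpoints is never needed.
  have hTfix : ∀ i ∉ mv, T' v i = 0 := by
    intro i hi
    have h1 := hTl i 1
    rcases P.fixed i hi with h2 | h2
    · rw [h2, h2] at h1; linarith
    · rw [h2, h2] at h1; linarith
  have hlin : ∀ x y : ℝ, HasDerivAt (fun s : ℝ => x + s * y) y 0 := fun x y => by
    simpa using ((hasDerivAt_id (0 : ℝ)).mul_const y).const_add x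
  have hd2 : HasDerivAt (fun s : ℝ => bar (F (p + s • v)))
      (∑ i, (W' v i • bar (γ (T p i)) +
        (W p i * T' v i) • deriv (fun t => bar (γ t)) (T p i))) 0 := by
    have hF : (fun s : ℝ => bar (F (p + s • v))) = fun s : ℝ =>
        ∑ i, (W p i + s * W' v i) • bar (γ (T p i + s * T' v i)) := by
      funext s
      rw [P.bar_eq_sum]
      simp only [hWl, hTl]
    rw [hF]
    refine HasDerivAt.fun_sum fun i _ => ?_
    have hg : HasDerivAt (fun s : ℝ => bar (γ (T p i + s * T' v i)))
        (T' v i • deriv (fun t => bar (γ t)) (T p i)) 0 := by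
      by_cases hi : i ∈ mv
      · have h1 : HasDerivAt (fun t => bar (γ t)) (deriv (fun t => bar (γ t)) (T p i))
            (T p i + 0 * T' v i) := by
          rw [zero_mul, add_zero]
          exact (h.differentiableAt_bar (((P.mem_interior p).1 hp).2.1 i hi)).hasDerivAt
        exact HasDerivAt.scomp (0 : ℝ) h1 (hlin _ _)
      · rw [hTfix i hi]
        simpa using hasDerivAt_const (0 : ℝ) (bar (γ (T p i)))
    have := (hlin (W p i) (W' v i)).smul hg
    rw [zero_mul, add_zero, zero_mul, add_zero, smul_smul, add_comm] at this
    exact this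
  have hrel := hd2.unique hd1
  obtain ⟨h1, h2⟩ := P.relation_trivial h hp (x := fun i => W' v i)
    (y := fun i => W p i * T' v i) (by
      have h1 := P.sum_W (p + (1 : ℝ) • v)
      simp only [hWl, one_mul, Finset.sum_add_distrib, P.sum_W] at h1
      linarith) (fun i hi => by simp [hTfix i hi]) hrel
  have hW0 : W' v = 0 := h1
  have hT0 : T' v = 0 := by
    funext i
    exact (mul_eq_zero.1 (congrFun h2 i)).resolve_left (((P.mem_interior p).1 hp).1 i).ne'
  have := P.inj (p + v) p (by rw [hW (p + v), hW p, map_add, hW0, add_zero])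
    (by rw [hT (p + v), hT p, map_add, hT0, add_zero])
  simpa using this

lemma exists_hasFDerivAt_bar (P : HullParam n a b γ D F N mv W T σ) (h : IsTorsionCurve n a b γ)
    {p : X} (hp : p ∈ interior D) :
    ∃ e : X ≃L[ℝ] (Fin n → ℝ), HasFDerivAt (fun p => bar (F p)) (e : X →L[ℝ] (Fin n → ℝ)) p := by
  have := P.finiteDimensional
  let e : X ≃ₗ[ℝ] (Fin n → ℝ) := LinearEquiv.ofInjectiveOfFinrankEq
    (fderiv ℝ (fun p => bar (F p)) p : X →ₗ[ℝ] (Fin n → ℝ)) (P.fderiv_bar_injective h hp)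
    (by simp [P.finrank])
  refine ⟨e.toContinuousLinearEquiv, ?_⟩
  have : (e.toContinuousLinearEquiv : X →L[ℝ] (Fin n → ℝ)) = fderiv ℝ (fun p => bar (F p)) p := by
    ext1 v
    rfl
  rw [this]
  exact ((P.contDiffAt_bar h hp).differentiableAt (by norm_cast)).hasFDerivAt

lemma map_nhds_bar (P : HullParam n a b γ D F N mv W T σ) (h : IsTorsionCurve n a b γ)
    {p : X} (hp : p ∈ interior D) :
    map (fun p => bar (F p)) (𝓝 p) = 𝓝 (bar (F p)) := by
  have := P.finiteDimensional
  have : CompleteSpace X := FiniteDimensional.complete ℝ X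
  obtain ⟨e, he⟩ := P.exists_hasFDerivAt_bar h hp
  exact ((P.contDiffAt_bar h hp).hasStrictFDerivAt' he (by norm_cast)).map_nhds_eq_of_equiv

lemma isOpen_image (P : HullParam n a b γ D F N mv W T σ) (h : IsTorsionCurve n a b γ) :
    IsOpen ((fun p => bar (F p)) '' interior D) := by
  rw [isOpen_iff_mem_nhds]
  rintro _ ⟨p, hp, rfl⟩
  rw [← P.map_nhds_bar h hp]
  exact image_mem_map (isOpen_interior.mem_nhds hp)

lemma bar_mem_hull (P : HullParam n a b γ D F N mv W T σ) {p : X} (hp : p ∈ D) :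
    bar (F p) ∈ convexHull ℝ ((fun t => bar (γ t)) '' Icc a b) :=
  IsTorsionCurve.bar_mem_convexHull (P.mem_convexHull hp)

lemma bar_mem_interior (P : HullParam n a b γ D F N mv W T σ) (h : IsTorsionCurve n a b γ)
    {p : X} (hp : p ∈ interior D) :
    bar (F p) ∈ interior (convexHull ℝ ((fun t => bar (γ t)) '' Icc a b)) :=
  interior_maximal (by rintro _ ⟨q, hq, rfl⟩; exact P.bar_mem_hull (interior_subset hq))
    (P.isOpen_image h) ⟨p, hp, rfl⟩

lemma hull_interior_nonempty (P : HullParam n a b γ D F N mv W T σ)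
    (h : IsTorsionCurve n a b γ) :
    (interior (convexHull ℝ ((fun t => bar (γ t)) '' Icc a b))).Nonempty := by
  obtain ⟨p, hp⟩ := P.interior_nonempty
  exact ⟨_, P.bar_mem_interior h hp⟩

lemma isCompact_image (P : HullParam n a b γ D F N mv W T σ) (h : IsTorsionCurve n a b γ) :
    IsCompact ((fun p => bar (F p)) '' D) :=
  P.isCompact.image_of_continuousOn
    ((contDiff_bar (r := 0)).continuous.comp_continuousOn (P.continuousOn h))

/-- The image of the interior is open and closed in the interior of the hull. -/
lemma image_interior (P : HullParam n a b γ D F N mv W T σ) (h : IsTorsionCurve n a b γ) :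
    (fun p => bar (F p)) '' interior D =
      interior (convexHull ℝ ((fun t => bar (γ t)) '' Icc a b)) := by
  set K := convexHull ℝ ((fun t => bar (γ t)) '' Icc a b) with hK
  refine Subset.antisymm (by rintro _ ⟨p, hp, rfl⟩; exact P.bar_mem_interior h hp) ?_
  have hpre : IsPreconnected (interior K) := (convex_convexHull ℝ _).interior.isPreconnected
  -- The second open set is the complement of the compact image of `D`. Together they cover `int K`,
  -- because parameters outside `interior D` never land there.
  refine hpre.subset_left_of_subset_union (P.isOpen_image h)
    (P.isCompact_image h).isClosed.isOpen_compl ?_ ?_ ?_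
  · rw [disjoint_compl_right_iff_subset]
    exact image_mono interior_subset
  · intro y hy
    by_cases hyD : y ∈ (fun p => bar (F p)) '' D
    · left
      obtain ⟨p, hp, rfl⟩ := hyD
      refine ⟨p, ?_, rfl⟩
      by_contra hp'
      exact P.bar_notMem_interior h hp hp' hy
    · exact Or.inr hyD
  · obtain ⟨p, hp⟩ := P.interior_nonempty
    exact ⟨_, P.bar_mem_interior h hp, p, hp, rfl⟩

/-- The compact image contains `int K`, hence its closure, which contains `K`. -/
lemma image_eq (P : HullParam n a b γ D F N mv W T σ) (h : IsTorsionCurve n a b γ) :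
    (fun p => bar (F p)) '' D = convexHull ℝ ((fun t => bar (γ t)) '' Icc a b) := by
  refine Subset.antisymm (by rintro _ ⟨p, hp, rfl⟩; exact P.bar_mem_hull hp) ?_
  refine subset_closure.trans ?_
  rw [← (convex_convexHull ℝ _).closure_interior_eq_closure_of_nonempty_interior
    (P.hull_interior_nonempty h)]
  refine closure_minimal ?_ (P.isCompact_image h).isClosed
  rw [← P.image_interior h]
  exact image_mono interior_subset

lemma isClosed_hull (P : HullParam n a b γ D F N mv W T σ) (h : IsTorsionCurve n a b γ) :
    IsClosed (convexHull ℝ ((fun t => bar (γ t)) '' Icc a b)) := by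
  rw [← P.image_eq h]
  exact (P.isCompact_image h).isClosed

lemma image_frontier (P : HullParam n a b γ D F N mv W T σ) (h : IsTorsionCurve n a b γ) :
    (fun p => bar (F p)) '' frontier D =
      frontier (convexHull ℝ ((fun t => bar (γ t)) '' Icc a b)) := by
  rw [P.isCompact.isClosed.frontier_eq, (P.isClosed_hull h).frontier_eq]
  ext y
  constructor
  · rintro ⟨p, ⟨hp, hp'⟩, rfl⟩
    exact ⟨P.bar_mem_hull hp, P.bar_notMem_interior h hp hp'⟩
  · rintro ⟨hy, hy'⟩
    rw [← P.image_eq h] at hy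
    obtain ⟨p, hp, rfl⟩ := hy
    exact ⟨p, ⟨hp, fun hp' => hy' (P.bar_mem_interior h hp')⟩, rfl⟩

/-- `F p` is extremal in its fibre. -/
lemma extremal (P : HullParam n a b γ D F N mv W T σ) (h : IsTorsionCurve n a b γ)
    {p : X} (hp : p ∈ D) {v : Fin (n + 1) → ℝ} (hv : v ∈ convexHull ℝ (γ '' Icc a b))
    (hvp : bar v = bar (F p)) : σ * zc v ≤ σ * zc (F p) := by
  by_cases hp' : p ∈ interior D
  · exact P.extremal_interior h hp' hv hvp
  · rw [h.fiber_unique (P.hull_interior_nonempty h) hv (P.mem_convexHull hp) hvp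
      (by rw [hvp]; exact P.bar_notMem_interior h hp hp')]

lemma sign_cases (P : HullParam n a b γ D F N mv W T σ) : σ = 1 ∨ σ = -1 :=
  P.side.imp (fun h => h.1) fun h => h.1

lemma wellDefined (P : HullParam n a b γ D F N mv W T σ) (h : IsTorsionCurve n a b γ)
    {p q : X} (hp : p ∈ D) (hq : q ∈ D) (hpq : bar (F p) = bar (F q)) : zc (F p) = zc (F q) := by
  have h1 := P.extremal h hp (P.mem_convexHull hq) hpq.symm
  have h2 := P.extremal h hq (P.mem_convexHull hp) hpq
  rcases P.sign_cases with rfl | rfl <;> linarith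

lemma ext_bar_zc {v w : Fin (n + 1) → ℝ} (h1 : bar v = bar w) (h2 : zc v = zc w) : v = w := by
  funext i
  refine Fin.lastCases h2 (fun j => congrFun h1 j) i

/-- Extremality upgrades equal projections to equal points of the hull. Each parameter's nodes are
then contact points for the other, so the increasing node tuples have the same range and coincide;
independence gives the weights. -/
lemma injOn (P : HullParam n a b γ D F N mv W T σ) (h : IsTorsionCurve n a b γ) :
    InjOn (fun p => bar (F p)) (interior D) := by
  intro p hp q hq hpq
  have hpq' : bar (F p) = bar (F q) := hpq
  have hF : F p = F q := ext_bar_zc hpq'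
    (P.wellDefined h (interior_subset hp) (interior_subset hq) hpq')
  obtain ⟨hp1, hp2, hp3⟩ := (P.mem_interior p).1 hp
  obtain ⟨hq1, hq2, hq3⟩ := (P.mem_interior q).1 hq
  have hsub1 : ∀ j, ∃ i, T p i = T q j := P.nodes_subset h hp hq1 (P.sum_W q)
    (P.T_mem_Icc hq) (by rw [← P.eq_sum, hF])
  have hsub2 : ∀ j, ∃ i, T q i = T p j := P.nodes_subset h hq hp1 (P.sum_W p)
    (P.T_mem_Icc hp) (by rw [← P.eq_sum, hF])
  have hT : T p = T q := by
    refine (StrictMono.range_inj hp3 hq3).1 (Subset.antisymm ?_ ?_)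
    · rintro _ ⟨j, rfl⟩; exact hsub2 j
    · rintro _ ⟨j, rfl⟩; exact hsub1 j
  have hrel : ∑ i, ((W p i - W q i) • bar (γ (T p i)) +
      (0 : ℝ) • deriv (fun t => bar (γ t)) (T p i)) = 0 := by
    have h2 := sub_eq_zero.2 hpq'
    rw [P.bar_eq_sum, P.bar_eq_sum, ← hT, ← Finset.sum_sub_distrib] at h2
    rw [← h2]
    exact Finset.sum_congr rfl fun i _ => by rw [zero_smul, add_zero, sub_smul]
  have := (P.relation_trivial h hp (x := fun i => W p i - W q i) (y := 0)
    (by simp [P.sum_W]) (by simp) hrel).1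
  refine P.inj p q (funext fun i => ?_) hT
  exact sub_eq_zero.1 (congrFun this i)

lemma isDiffeoOn (P : HullParam n a b γ D F N mv W T σ) (h : IsTorsionCurve n a b γ) :
    IsDiffeoOn (n + 1) (fun p => bar (F p)) (interior D)
      (interior (convexHull ℝ ((fun t => bar (γ t)) '' Icc a b))) := by
  have := P.finiteDimensional
  have : CompleteSpace X := FiniteDimensional.complete ℝ X
  refine isDiffeoOn_of_bijOn n.succ_ne_zero isOpen_interior ?_
    (fun p hp => P.contDiffAt_bar h hp) (fun p hp => P.exists_hasFDerivAt_bar h hp)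
  rw [← P.image_interior h]
  exact (P.injOn h).bijOn_image

/-! ### Regularity and extremality of the graph functions -/

variable {B : (Fin n → ℝ) → ℝ}

/-- The projection from the compact `D` is a closed map onto `K`: the preimage of a closed set under
`B` is the image of a compact set of parameters. -/
lemma graph_continuousOn (P : HullParam n a b γ D F N mv W T σ) (h : IsTorsionCurve n a b γ)
    (hB : IsGraphFunction D F B) :
    ContinuousOn B (convexHull ℝ ((fun t => bar (γ t)) '' Icc a b)) := by
  rw [continuousOn_iff_isClosed]
  intro t ht
  have hz : ContinuousOn (fun p => zc (F p)) D :=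
    (contDiff_zc (r := 0)).continuous.comp_continuousOn (P.continuousOn h)
  have hcl : IsClosed (D ∩ (fun p => zc (F p)) ⁻¹' t) :=
    hz.preimage_isClosed_of_isClosed P.isCompact.isClosed ht
  have hc : IsCompact (D ∩ (fun p => zc (F p)) ⁻¹' t) := P.isCompact.of_isClosed_subset hcl
    inter_subset_left
  have hb : ContinuousOn (fun p => bar (F p)) D :=
    (contDiff_bar (r := 0)).continuous.comp_continuousOn (P.continuousOn h)
  refine ⟨_, (hc.image_of_continuousOn (hb.mono inter_subset_left)).isClosed, ?_⟩
  rw [← P.image_eq h]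
  ext y
  constructor
  · rintro ⟨hy, p, hp, rfl⟩
    refine ⟨⟨p, ⟨hp, ?_⟩, rfl⟩, p, hp, rfl⟩
    have : B (bar (F p)) ∈ t := hy
    rwa [hB p hp] at this
  · rintro ⟨⟨p, ⟨hp, hpt⟩, rfl⟩, hy⟩
    refine ⟨?_, hy⟩
    change B (bar (F p)) ∈ t
    rw [hB p hp]
    exact hpt

lemma graph_contDiffOn (P : HullParam n a b γ D F N mv W T σ) (h : IsTorsionCurve n a b γ)
    (hB : IsGraphFunction D F B) :
    ContDiffOn ℝ 1 B (interior (convexHull ℝ ((fun t => bar (γ t)) '' Icc a b))) := by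
  obtain ⟨hbij, _, G, hG, hGs⟩ := P.isDiffeoOn h
  have hmaps : MapsTo G (interior (convexHull ℝ ((fun t => bar (γ t)) '' Icc a b)))
      (interior D) := hG.1.mapsTo hbij.surjOn
  have hle : (1 : WithTop ℕ∞) ≤ ((n + 1 : ℕ) : WithTop ℕ∞) := by norm_cast; omega
  have hz : ContDiffOn ℝ 1 (fun p => zc (F p)) (interior D) := fun p hp =>
    ((contDiff_zc.contDiffAt.comp p (P.contDiffAt h hp)).of_le hle).contDiffWithinAt
  refine (hz.comp (hGs.of_le hle) hmaps).congr fun y hy => ?_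
  have h1 : bar (F (G y)) = y := hG.2 hy
  change B y = zc (F (G y))
  rw [← hB _ (interior_subset (hmaps hy)), h1]

lemma graph_extremal (P : HullParam n a b γ D F N mv W T σ) (h : IsTorsionCurve n a b γ)
    (hB : IsGraphFunction D F B) {v : Fin (n + 1) → ℝ} (hv : v ∈ convexHull ℝ (γ '' Icc a b)) :
    σ * zc v ≤ σ * B (bar v) := by
  have hy := IsTorsionCurve.bar_mem_convexHull hv
  rw [← P.image_eq h] at hy
  obtain ⟨p, hp, hpv⟩ := hy
  have hpv' : bar (F p) = bar v := hpv
  rw [← hpv', hB p hp]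
  exact P.extremal h hp hv hpv'.symm

lemma graph_mem (P : HullParam n a b γ D F N mv W T σ) (h : IsTorsionCurve n a b γ)
    (hB : IsGraphFunction D F B) {y : Fin n → ℝ}
    (hy : y ∈ convexHull ℝ ((fun t => bar (γ t)) '' Icc a b)) :
    ∃ p ∈ D, bar (F p) = y ∧ zc (F p) = B y := by
  rw [← P.image_eq h] at hy
  obtain ⟨p, hp, rfl⟩ := hy
  exact ⟨p, hp, rfl, (hB p hp).symm⟩

/-- A convex combination of two graph points lies in the hull, and `σ * B` bounds `σ * zc` there. -/
lemma graph_concaveOn (P : HullParam n a b γ D F N mv W T σ) (h : IsTorsionCurve n a b γ)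
    (hB : IsGraphFunction D F B) :
    ConcaveOn ℝ (convexHull ℝ ((fun t => bar (γ t)) '' Icc a b)) (fun y => σ * B y) := by
  refine ⟨convex_convexHull ℝ _, fun x hx y hy s r hs hr hsr => ?_⟩
  obtain ⟨p, hp, rfl, hpz⟩ := P.graph_mem h hB hx
  obtain ⟨q, hq, rfl, hqz⟩ := P.graph_mem h hB hy
  have := P.graph_extremal h hB
    ((convex_convexHull ℝ _) (P.mem_convexHull hp) (P.mem_convexHull hq) hs hr hsr)
  have hz : zc (s • F p + r • F q) = s * zc (F p) + r * zc (F q) := rfl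
  have hb : bar (s • F p + r • F q) = s • bar (F p) + r • bar (F q) := rfl
  rw [hz, hb, hpz, hqz] at this
  simp only [smul_eq_mul]
  linarith

/-- Jensen's inequality for the convex combination that defines `F p`. -/
lemma graph_le (P : HullParam n a b γ D F N mv W T σ) (h : IsTorsionCurve n a b γ)
    (hB : IsGraphFunction D F B) {G : (Fin n → ℝ) → ℝ}
    (hG : ConcaveOn ℝ (convexHull ℝ ((fun t => bar (γ t)) '' Icc a b)) (fun y => σ * G y))
    (hGγ : ∀ t ∈ Icc a b, σ * zc (γ t) ≤ σ * G (bar (γ t))) :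
    ∀ x ∈ convexHull ℝ ((fun t => bar (γ t)) '' Icc a b), σ * B x ≤ σ * G x := by
  intro x hx
  obtain ⟨p, hp, rfl, hpz⟩ := P.graph_mem h hB hx
  obtain ⟨h1, h2, _⟩ := P.mem p hp
  have hJ := hG.le_map_sum (t := Finset.univ) (fun i _ => h1 i) (P.sum_W p)
    (fun i _ => subset_convexHull ℝ _ ⟨T p i, h2 i, rfl⟩)
  rw [← hpz, P.zc_eq_sum, P.bar_eq_sum]
  refine le_trans ?_ hJ
  rw [Finset.mul_sum]
  refine Finset.sum_le_sum fun i _ => ?_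
  have := mul_le_mul_of_nonneg_left (hGγ _ (h2 i)) (h1 i)
  rw [smul_eq_mul]
  linarith

end HullParam

/-! ### The boundary of the full convex hull -/

section JoinLast

variable {n : ℕ}

@[simp] lemma bar_joinLast (x : Fin n → ℝ) (z : ℝ) : bar (joinLast x z) = x := by
  funext i; simp [bar, joinLast]

@[simp] lemma zc_joinLast (x : Fin n → ℝ) (z : ℝ) : zc (joinLast x z) = z := by
  simp [zc, joinLast]

lemma joinLast_bar_zc (v : Fin (n + 1) → ℝ) : joinLast (bar v) (zc v) = v :=
  HullParam.ext_bar_zc (by simp) (by simp)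

lemma continuous_joinLast (x : Fin n → ℝ) : Continuous fun z => joinLast x z := by
  refine continuous_pi fun i => ?_
  refine Fin.lastCases ?_ (fun j => ?_) i
  · simpa [joinLast] using continuous_id'
  · simpa [joinLast] using continuous_const

end JoinLast

namespace HullParam

variable {n : ℕ} {a b : ℝ} {γ : ℝ → Fin (n + 1) → ℝ} {X : Type*} [NormedAddCommGroup X]
    [NormedSpace ℝ X] {D : Set X} {F : X → Fin (n + 1) → ℝ} {N : ℕ} {mv : Finset (Fin N)}
    {W T : X → Fin N → ℝ} {σ : ℝ} {B : (Fin n → ℝ) → ℝ}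

lemma joinLast_graph_mem (P : HullParam n a b γ D F N mv W T σ) (h : IsTorsionCurve n a b γ)
    (hB : IsGraphFunction D F B) {x : Fin n → ℝ}
    (hx : x ∈ convexHull ℝ ((fun t => bar (γ t)) '' Icc a b)) :
    joinLast x (B x) ∈ convexHull ℝ (γ '' Icc a b) := by
  obtain ⟨p, hp, rfl, hz⟩ := P.graph_mem h hB hx
  rw [← hz, joinLast_bar_zc]
  exact P.mem_convexHull hp

lemma joinLast_graph_notMem_interior (P : HullParam n a b γ D F N mv W T σ)
    (h : IsTorsionCurve n a b γ) (hB : IsGraphFunction D F B) (x : Fin n → ℝ) :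
    joinLast x (B x) ∉ interior (convexHull ℝ (γ '' Icc a b)) := by
  intro hx
  -- Moving vertically in the direction `σ` leaves the hull at once, by extremality.
  have hcont : ContinuousAt (fun s : ℝ => joinLast x (B x + σ * s)) 0 :=
    ((continuous_joinLast x).comp (by fun_prop)).continuousAt
  have hev : ∀ᶠ s in 𝓝 (0 : ℝ), joinLast x (B x + σ * s) ∈ convexHull ℝ (γ '' Icc a b) := by
    refine hcont ?_
    simp only [mul_zero, add_zero]
    exact mem_interior_iff_mem_nhds.1 hx
  obtain ⟨s, hs, hs0⟩ := ((hev.filter_mono (nhdsWithin_le_nhds (s := Ioi 0))).and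
    self_mem_nhdsWithin).exists
  have := P.graph_extremal h hB hs
  rw [bar_joinLast, zc_joinLast] at this
  have hs0' : 0 < s := hs0
  rcases P.sign_cases with rfl | rfl <;> linarith

lemma graph_unique_of_notMem_interior (P : HullParam n a b γ D F N mv W T σ)
    (h : IsTorsionCurve n a b γ) (hB : IsGraphFunction D F B) {v : Fin (n + 1) → ℝ}
    (hv : v ∈ convexHull ℝ (γ '' Icc a b))
    (hint : bar v ∉ interior (convexHull ℝ ((fun t => bar (γ t)) '' Icc a b))) :
    B (bar v) = zc v := by
  obtain ⟨p, hp, hpb, hpz⟩ := P.graph_mem h hB (IsTorsionCurve.bar_mem_convexHull hv)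
  rw [← hpz]
  exact h.fiber_unique (P.hull_interior_nonempty h) (P.mem_convexHull hp) hv hpb
    (by rwa [hpb])

/-- For `n ≥ 2` the projected curve lies on the boundary of its convex hull. -/
lemma _root_.IsTorsionCurve.bar_notMem_interior (h : IsTorsionCurve n a b γ) (hn : 2 ≤ n) {t : ℝ}
    (ht : t ∈ Icc a b) :
    bar (γ t) ∉ interior (convexHull ℝ ((fun t => bar (γ t)) '' Icc a b)) := by
  have hw : weight a b {t} ≤ n := by
    classical
    rw [weight]
    have := Finset.card_filter_le {t} (· ∈ Ioo a b)
    simp only [Finset.card_singleton] at this ⊢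
    omega
  obtain ⟨c₀, φ, h5, h6, h7⟩ := h.exists_supporting (Z := {t}) (by simpa using ht) (by simp) hw
  exact notMem_interior_of_supporting h5 (IsTorsionCurve.supporting_on_hull h6)
    (h7 t (by simp))

lemma graph_curve (P : HullParam n a b γ D F N mv W T σ) (h : IsTorsionCurve n a b γ)
    (hB : IsGraphFunction D F B) (hn : 2 ≤ n) {t : ℝ} (ht : t ∈ Icc a b) :
    B (bar (γ t)) = zc (γ t) :=
  P.graph_unique_of_notMem_interior h hB (subset_convexHull ℝ _ ⟨t, ht, rfl⟩)
    (h.bar_notMem_interior hn ht)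

variable {Y : Type*} [NormedAddCommGroup Y] [NormedSpace ℝ Y] {DU : Set X} {DL : Set Y}
    {U : X → Fin (n + 1) → ℝ} {L : Y → Fin (n + 1) → ℝ} {NU NL : ℕ} {mU : Finset (Fin NU)}
    {mL : Finset (Fin NL)} {WU TU : X → Fin NU → ℝ} {WL TL : Y → Fin NL → ℝ}
    {Bsup Binf : (Fin n → ℝ) → ℝ}

/-- If top and bottom agreed, the nodes of the upper representation would be nodes of the lower one;
but `b` is a node only of the upper. -/
lemma graph_ne_of_mem_interior (PU : HullParam n a b γ DU U NU mU WU TU 1)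
    (PL : HullParam n a b γ DL L NL mL WL TL (-1)) (h : IsTorsionCurve n a b γ)
    (hU : IsGraphFunction DU U Bsup) (hL : IsGraphFunction DL L Binf) {y : Fin n → ℝ}
    (hy : y ∈ interior (convexHull ℝ ((fun t => bar (γ t)) '' Icc a b))) : Binf y ≠ Bsup y := by
  intro heq
  have hy1 := hy
  have hy2 := hy
  rw [← PU.image_interior h] at hy1
  rw [← PL.image_interior h] at hy2
  obtain ⟨p, hp, hpy⟩ := hy1
  obtain ⟨q, hq, hqy⟩ := hy2
  have hpy' : bar (U p) = y := hpy
  have hqy' : bar (L q) = y := hqy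
  have hUL : U p = L q := ext_bar_zc (by rw [hpy', hqy'])
    (by rw [← hU p (interior_subset hp), ← hL q (interior_subset hq), hpy', hqy', heq])
  obtain ⟨i, hi⟩ : ∃ i, TU p i = b := by
    rcases PU.side with ⟨_, hs⟩ | ⟨h1, _⟩
    · exact hs p hp
    · norm_num at h1
  have hne : ∀ i, TL q i ≠ b := by
    rcases PL.side with ⟨h1, _⟩ | ⟨_, hs⟩
    · norm_num at h1
    · exact hs q hq
  obtain ⟨j, hj⟩ := PL.nodes_subset h hq ((PU.mem_interior p).1 hp).1 (PU.sum_W p)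
    (PU.T_mem_Icc hp) (by rw [← PU.eq_sum, hUL]) i
  exact hne j (hj.trans hi)

lemma graph_eq_iff (PU : HullParam n a b γ DU U NU mU WU TU 1)
    (PL : HullParam n a b γ DL L NL mL WL TL (-1)) (h : IsTorsionCurve n a b γ)
    (hU : IsGraphFunction DU U Bsup) (hL : IsGraphFunction DL L Binf) {y : Fin n → ℝ}
    (hy : y ∈ convexHull ℝ ((fun t => bar (γ t)) '' Icc a b)) :
    Binf y = Bsup y ↔ y ∈ frontier (convexHull ℝ ((fun t => bar (γ t)) '' Icc a b)) := by
  rw [(PU.isClosed_hull h).frontier_eq]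
  refine ⟨fun heq => ⟨hy, fun hi => PU.graph_ne_of_mem_interior PL h hU hL hi heq⟩, fun hf => ?_⟩
  have := PL.graph_unique_of_notMem_interior h hL (PU.joinLast_graph_mem h hU hy)
    (by rw [bar_joinLast]; exact hf.2)
  rwa [bar_joinLast, zc_joinLast] at this

/-- Each fibre is the vertical segment between the two graphs. The condition on `bar v` is repeated
so that each conjunct separately defines a closed set. -/
lemma mem_convexHull_iff (PU : HullParam n a b γ DU U NU mU WU TU 1)
    (PL : HullParam n a b γ DL L NL mL WL TL (-1)) (h : IsTorsionCurve n a b γ)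
    (hU : IsGraphFunction DU U Bsup) (hL : IsGraphFunction DL L Binf) {v : Fin (n + 1) → ℝ} :
    v ∈ convexHull ℝ (γ '' Icc a b) ↔
      (bar v ∈ convexHull ℝ ((fun t => bar (γ t)) '' Icc a b) ∧ Binf (bar v) ≤ zc v) ∧
      (bar v ∈ convexHull ℝ ((fun t => bar (γ t)) '' Icc a b) ∧ zc v ≤ Bsup (bar v)) := by
  constructor
  · intro hv
    have hb := IsTorsionCurve.bar_mem_convexHull hv
    have h1 := PU.graph_extremal h hU hv
    have h2 := PL.graph_extremal h hL hv
    exact ⟨⟨hb, by linarith⟩, hb, by linarith⟩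
  · rintro ⟨⟨hb, h1⟩, -, h2⟩
    have hmem : zc v ∈ segment ℝ (Binf (bar v)) (Bsup (bar v)) := by
      rw [segment_eq_Icc (h1.trans h2)]
      exact ⟨h1, h2⟩
    obtain ⟨s, r, hs, hr, hsr, hz⟩ := hmem
    convert (convex_convexHull ℝ _) (PL.joinLast_graph_mem h hL hb) (PU.joinLast_graph_mem h hU hb)
      hs hr hsr using 1
    refine ext_bar_zc ?_ ?_
    · change bar v = s • bar (joinLast (bar v) _) + r • bar (joinLast (bar v) _)
      rw [bar_joinLast, bar_joinLast, ← add_smul, hsr, one_smul]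
    · change zc v = s • zc (joinLast (bar v) _) + r • zc (joinLast (bar v) _)
      rw [zc_joinLast, zc_joinLast, hz]

lemma frontier_convexHull_eq (PU : HullParam n a b γ DU U NU mU WU TU 1)
    (PL : HullParam n a b γ DL L NL mL WL TL (-1)) (h : IsTorsionCurve n a b γ)
    (hU : IsGraphFunction DU U Bsup) (hL : IsGraphFunction DL L Binf) :
    frontier (convexHull ℝ (γ '' Icc a b)) =
      (fun x => joinLast x (Bsup x)) '' convexHull ℝ ((fun t => bar (γ t)) '' Icc a b) ∪
      (fun x => joinLast x (Binf x)) '' convexHull ℝ ((fun t => bar (γ t)) '' Icc a b) := by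
  set K := convexHull ℝ ((fun t => bar (γ t)) '' Icc a b) with hK
  have hbar : Continuous (bar : (Fin (n + 1) → ℝ) → Fin n → ℝ) := (contDiff_bar (r := 0)).continuous
  have hzc : Continuous (zc : (Fin (n + 1) → ℝ) → ℝ) := (contDiff_zc (r := 0)).continuous
  have hclosed : IsClosed (convexHull ℝ (γ '' Icc a b)) := by
    have hpre : IsClosed (bar ⁻¹' K) := (PU.isClosed_hull h).preimage hbar
    have h1 : IsClosed {v | v ∈ bar ⁻¹' K ∧ Binf (bar v) ≤ zc v} := hpre.isClosed_le
      ((PL.graph_continuousOn h hL).comp hbar.continuousOn fun _ hv => hv) hzc.continuousOn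
    have h2 : IsClosed {v | v ∈ bar ⁻¹' K ∧ zc v ≤ Bsup (bar v)} := hpre.isClosed_le
      hzc.continuousOn ((PU.graph_continuousOn h hU).comp hbar.continuousOn fun _ hv => hv)
    convert h1.inter h2 using 1
    ext v
    exact PU.mem_convexHull_iff PL h hU hL
  rw [hclosed.frontier_eq]
  ext v
  constructor
  · rintro ⟨hv, hvi⟩
    obtain ⟨⟨hb, h1⟩, -, h2⟩ := (PU.mem_convexHull_iff PL h hU hL).1 hv
    by_contra hnot
    have hne1 : zc v ≠ Bsup (bar v) := fun e => hnot (Or.inl ⟨bar v, hb, by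
      change joinLast (bar v) (Bsup (bar v)) = v
      rw [← e, joinLast_bar_zc]⟩)
    have hne2 : zc v ≠ Binf (bar v) := fun e => hnot (Or.inr ⟨bar v, hb, by
      change joinLast (bar v) (Binf (bar v)) = v
      rw [← e, joinLast_bar_zc]⟩)
    have h1' := lt_of_le_of_ne h1 hne2.symm
    have h2' := lt_of_le_of_ne h2 hne1
    -- Over `∂K` the graphs coincide, leaving no room strictly between them.
    have hbi : bar v ∈ interior K := by
      by_contra hbi
      have : bar v ∈ frontier K := by
        rw [(PU.isClosed_hull h).frontier_eq]; exact ⟨hb, hbi⟩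
      exact (h1'.trans h2').ne ((PU.graph_eq_iff PL h hU hL hb).2 this)
    have hnhds : K ∈ 𝓝 (bar v) := mem_interior_iff_mem_nhds.1 hbi
    have hc1 : ContinuousAt (fun w => Binf (bar w)) v :=
      ContinuousAt.comp (f := bar) ((PL.graph_continuousOn h hL).continuousAt hnhds)
        hbar.continuousAt
    have hc2 : ContinuousAt (fun w => Bsup (bar w)) v :=
      ContinuousAt.comp (f := bar) ((PU.graph_continuousOn h hU).continuousAt hnhds)
        hbar.continuousAt
    refine hvi (mem_interior_iff_mem_nhds.2 ?_)
    filter_upwards [hbar.continuousAt hnhds, hc1.eventually_lt hzc.continuousAt h1',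
      hzc.continuousAt.eventually_lt hc2 h2'] with w hw1 hw2 hw3
    exact (PU.mem_convexHull_iff PL h hU hL).2 ⟨⟨hw1, hw2.le⟩, hw1, hw3.le⟩
  · rintro (⟨x, hx, rfl⟩ | ⟨x, hx, rfl⟩)
    · exact ⟨PU.joinLast_graph_mem h hU hx, PU.joinLast_graph_notMem_interior h hU x⟩
    · exact ⟨PL.joinLast_graph_mem h hL hx, PL.joinLast_graph_notMem_interior h hL x⟩

/-- For `n = 1` the curve need not project to `∂K`, so the values of the lower graph on the curve
must be supplied by `hval`. -/
theorem describesHull (PU : HullParam n a b γ DU U NU mU WU TU 1)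
    (PL : HullParam n a b γ DL L NL mL WL TL (-1)) (h : IsTorsionCurve n a b γ) (hn : 1 ≤ n)
    (hval : n = 1 → ∀ t ∈ Icc a b, ∃ q ∈ DL, L q = γ t) :
    DescribesHull γ a b DU U DL L (convexHull ℝ ((fun t => bar (γ t)) '' Icc a b)) where
  boundary_upper := PU.image_frontier h
  boundary_lower := PL.image_frontier h
  diffeo_upper := PU.isDiffeoOn h
  diffeo_lower := PL.isDiffeoOn h
  image_upper := PU.image_eq h
  image_lower := PL.image_eq h
  wellDefined_upper _ hp _ hq := PU.wellDefined h hp hq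
  wellDefined_lower _ hp _ hq := PL.wellDefined h hp hq
  graphFunctions Bsup Binf hU hL := by
    have hconc : ConcaveOn ℝ (convexHull ℝ ((fun t => bar (γ t)) '' Icc a b)) Bsup := by
      simpa using PU.graph_concaveOn h hU
    have hconv : ConvexOn ℝ (convexHull ℝ ((fun t => bar (γ t)) '' Icc a b)) Binf := by
      have := (PL.graph_concaveOn h hL).neg
      rwa [show -(fun y => -1 * Binf y) = Binf by funext y; simp] at this
    have hmin : ∀ G : (Fin n → ℝ) → ℝ,
        ConcaveOn ℝ (convexHull ℝ ((fun t => bar (γ t)) '' Icc a b)) G →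
        (∀ t ∈ Icc a b, zc (γ t) ≤ G (bar (γ t))) →
        ∀ x ∈ convexHull ℝ ((fun t => bar (γ t)) '' Icc a b), Bsup x ≤ G x := by
      intro G hG hGγ x hx
      simpa using PU.graph_le h hU (G := G) (by simpa using hG) (by simpa using hGγ) x hx
    refine ⟨PU.graph_continuousOn h hU, PU.graph_contDiffOn h hU, PL.graph_continuousOn h hL,
      PL.graph_contDiffOn h hL, fun _ => ⟨hconc, fun t ht => ?_, hmin⟩,
      fun hn2 => ⟨hconc, fun t ht => PU.graph_curve h hU hn2 ht,
        fun G hG hGγ => hmin G hG fun t ht => (hGγ t ht).ge⟩,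
      ⟨hconv, fun t ht => ?_, fun G hG hGγ x hx => ?_⟩,
      fun y hy => PU.graph_eq_iff PL h hU hL hy, PU.frontier_convexHull_eq PL h hU hL⟩
    · simpa using PU.graph_extremal h hU (subset_convexHull ℝ _ ⟨t, ht, rfl⟩)
    · rcases Nat.lt_or_ge 1 n with hn2 | hn1
      · exact PL.graph_curve h hL hn2 ht
      · obtain ⟨q, hq, hqt⟩ := hval (by omega) t ht
        rw [← hqt]
        exact hL q hq
    · have := PL.graph_le h hL (G := G)
        (by have := hG.neg; rwa [show -G = fun y => -1 * G y by funext y; simp] at this)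
        (fun t ht => by rw [hGγ t ht]) x hx
      linarith

end HullParam

/-! ### Compactness and interiors of the parameter domains -/

section Domains

variable {a b : ℝ} {k : ℕ}

lemma isCompact_deltaC (k : ℕ) : IsCompact (DeltaC k) := by
  refine isCompact_Icc.of_isClosed_subset (s := Icc (0 : Fin k → ℝ) 1) ?_ ?_
  · rw [DeltaC, ofPred_and]
    refine IsClosed.inter ?_ (isClosed_le (by fun_prop) continuous_const)
    rw [ofPred_forall]
    exact isClosed_iInter fun j => isClosed_le continuous_const (continuous_apply j)
  · rintro r ⟨h0, h1⟩
    exact ⟨h0, fun j => (Finset.single_le_sum (fun i _ => h0 i) (Finset.mem_univ j)).trans h1⟩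

lemma isCompact_deltaStar (a b : ℝ) (k : ℕ) : IsCompact (DeltaStar a b k) := by
  refine isCompact_Icc.of_isClosed_subset (s := Icc (fun _ : Fin k => a) (fun _ => b)) ?_ ?_
  · rw [DeltaStar, ofPred_and]
    refine IsClosed.inter ?_ isClosed_monotone
    rw [ofPred_forall]
    exact isClosed_iInter fun j => isClosed_Icc.preimage (continuous_apply j)
  · rintro y ⟨h, -⟩
    exact ⟨fun j => (h j).1, fun j => (h j).2⟩

/-- Small displacements of an interior point stay in the set. -/
lemma exists_pos_add_smul_mem {E : Type*} [NormedAddCommGroup E] [NormedSpace ℝ E] {s : Set E}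
    {x : E} (hx : x ∈ interior s) (v : E) : ∃ ε > (0 : ℝ), x + ε • v ∈ s := by
  have hc : ContinuousAt (fun ε : ℝ => x + ε • v) 0 := by fun_prop
  have hev : ∀ᶠ ε in 𝓝 (0 : ℝ), x + ε • v ∈ s := by
    refine hc ?_
    simpa using mem_interior_iff_mem_nhds.1 hx
  obtain ⟨ε, h1, h2⟩ := ((hev.filter_mono (nhdsWithin_le_nhds (s := Ioi 0))).and
    self_mem_nhdsWithin).exists
  exact ⟨ε, h2, h1⟩

/-- Interior points can be pushed a little towards each constraint, which makes the inequalities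
strict. -/
lemma mem_interior_deltaC {r : Fin k → ℝ} :
    r ∈ interior (DeltaC k) ↔ (∀ j, 0 < r j) ∧ ∑ j, r j < 1 := by
  constructor
  · intro hr
    obtain ⟨ε, hε, h1, -⟩ := exists_pos_add_smul_mem hr (fun _ => -1)
    refine ⟨fun j => ?_, ?_⟩
    · have := h1 j
      simp only [Pi.add_apply, Pi.smul_apply, smul_eq_mul] at this
      linarith
    · rcases Nat.eq_zero_or_pos k with rfl | hk
      · simp
      obtain ⟨δ, hδ, -, h2⟩ := exists_pos_add_smul_mem hr (fun _ => 1)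
      simp only [Pi.add_apply, Pi.smul_apply, smul_eq_mul, mul_one, Finset.sum_add_distrib,
        Finset.sum_const, Finset.card_univ, Fintype.card_fin, nsmul_eq_mul] at h2
      have : 0 < (k : ℝ) * δ := mul_pos (by exact_mod_cast hk) hδ
      linarith
  · intro hr
    have hopen : IsOpen {r : Fin k → ℝ | (∀ j, 0 < r j) ∧ ∑ j, r j < 1} := by
      rw [ofPred_and]
      refine IsOpen.inter ?_ (isOpen_lt (by fun_prop) continuous_const)
      rw [ofPred_forall]
      exact isOpen_iInter_of_finite fun j => isOpen_lt continuous_const (continuous_apply j)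
    exact interior_maximal
      (by rintro r ⟨h1, h2⟩; exact ⟨fun j => (h1 j).le, h2.le⟩) hopen hr

lemma mem_interior_deltaStar {y : Fin k → ℝ} :
    y ∈ interior (DeltaStar a b k) ↔ (∀ j, y j ∈ Ioo a b) ∧ StrictMono y := by
  constructor
  · intro hy
    refine ⟨fun j => ⟨?_, ?_⟩, fun i j hij => ?_⟩
    · obtain ⟨ε, hε, h1, -⟩ := exists_pos_add_smul_mem hy (fun _ => -1)
      have := (h1 j).1
      simp only [Pi.add_apply, Pi.smul_apply, smul_eq_mul] at this
      linarith
    · obtain ⟨ε, hε, h1, -⟩ := exists_pos_add_smul_mem hy (fun _ => 1)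
      have := (h1 j).2
      simp only [Pi.add_apply, Pi.smul_apply, smul_eq_mul] at this
      linarith
    · obtain ⟨ε, hε, -, h1⟩ := exists_pos_add_smul_mem hy (Pi.single i 1)
      have := h1 hij.le
      simp only [Pi.add_apply, Pi.smul_apply, smul_eq_mul, Pi.single_eq_same,
        Pi.single_eq_of_ne hij.ne'] at this
      linarith
  · intro hy
    have hopen : IsOpen {y : Fin k → ℝ | (∀ j, y j ∈ Ioo a b) ∧ ∀ i j, i < j → y i < y j} := by
      rw [ofPred_and]
      refine IsOpen.inter ?_ ?_
      · rw [ofPred_forall]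
        exact isOpen_iInter_of_finite fun j => isOpen_Ioo.preimage (continuous_apply j)
      · simp only [ofPred_forall]
        exact isOpen_iInter_of_finite fun i => isOpen_iInter_of_finite fun j =>
          isOpen_iInter_of_finite fun _ => isOpen_lt (continuous_apply i) (continuous_apply j)
    exact interior_maximal (by
      rintro y ⟨h1, h2⟩
      exact ⟨fun j => Ioo_subset_Icc_self (h1 j), StrictMono.monotone fun i j => h2 i j⟩)
      hopen ⟨hy.1, fun i j h => hy.2 h⟩

lemma interior_deltaC_nonempty (k : ℕ) : (interior (DeltaC k)).Nonempty := by
  have hk : (0 : ℝ) < k + 1 := by positivity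
  refine ⟨fun _ => 1 / (k + 1), mem_interior_deltaC.2 ⟨fun _ => by positivity, ?_⟩⟩
  rw [Finset.sum_const, Finset.card_univ, Fintype.card_fin, nsmul_eq_mul, mul_one_div,
    div_lt_one hk]
  linarith

lemma interior_deltaStar_nonempty (hab : a < b) (k : ℕ) :
    (interior (DeltaStar a b k)).Nonempty := by
  have hk : (0 : ℝ) < k + 1 := by positivity
  have hpos : 0 < (b - a) / (k + 1) := div_pos (sub_pos.2 hab) hk
  refine ⟨fun j => a + (j + 1) * ((b - a) / (k + 1)), mem_interior_deltaStar.2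
    ⟨fun j => ⟨?_, ?_⟩, fun i j hij => ?_⟩⟩
  · have : (0 : ℝ) < (j : ℝ) + 1 := by positivity
    have := mul_pos this hpos
    linarith
  · have h1 : ((j : ℕ) : ℝ) + 1 < k + 1 := by
      have : ((j : ℕ) : ℝ) < k := by exact_mod_cast j.2
      linarith
    have h2 := mul_lt_mul_of_pos_right h1 hpos
    rw [mul_div_cancel₀ _ hk.ne'] at h2
    linarith
  · have h1 : ((i : ℕ) : ℝ) + 1 < (j : ℕ) + 1 := by
      have : ((i : ℕ) : ℝ) < (j : ℕ) := by exact_mod_cast hij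
      linarith
    have h2 := mul_lt_mul_of_pos_right h1 hpos
    simp only
    linarith

end Domains

/-! ### Tuples extended by an endpoint, and affine coordinates -/

section Tuples

variable {k : ℕ} {x : Fin k → ℝ} {e : ℝ}

lemma monotone_cons (h : ∀ j, e ≤ x j) (hx : Monotone x) :
    Monotone (Fin.cons e x : Fin (k + 1) → ℝ) := by
  intro i j
  refine Fin.cases ?_ (fun i => ?_) i <;> refine Fin.cases ?_ (fun j => ?_) j
  · simp
  · intro _; simpa using h j
  · intro hij; simp at hij
  · intro hij; simpa using hx (Fin.succ_le_succ_iff.1 hij)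

lemma monotone_snoc (h : ∀ j, x j ≤ e) (hx : Monotone x) :
    Monotone (Fin.snoc (α := fun _ => ℝ) x e : Fin (k + 1) → ℝ) := by
  intro i j
  refine Fin.lastCases ?_ (fun i => ?_) i <;> refine Fin.lastCases ?_ (fun j => ?_) j
  · simp
  · intro hij; exact absurd hij (not_le.2 (Fin.castSucc_lt_last j))
  · intro _; simpa using h i
  · intro hij; simpa using hx (Fin.castSucc_le_castSucc_iff.1 hij)

lemma strictMono_cons_iff :
    StrictMono (Fin.cons e x : Fin (k + 1) → ℝ) ↔ (∀ j, e < x j) ∧ StrictMono x := by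
  constructor
  · intro h
    exact ⟨fun j => by simpa using h (Fin.succ_pos j),
      fun i j hij => by simpa using h (Fin.succ_lt_succ_iff.2 hij)⟩
  · rintro ⟨h, hx⟩ i j
    refine Fin.cases ?_ (fun i => ?_) i <;> refine Fin.cases ?_ (fun j => ?_) j
    · simp
    · intro _; simpa using h j
    · intro hij; simp at hij
    · intro hij; simpa using hx (Fin.succ_lt_succ_iff.1 hij)

lemma strictMono_snoc_iff :
    StrictMono (Fin.snoc (α := fun _ => ℝ) x e : Fin (k + 1) → ℝ) ↔
      (∀ j, x j < e) ∧ StrictMono x := by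
  constructor
  · intro h
    exact ⟨fun j => by simpa using h (Fin.castSucc_lt_last j),
      fun i j hij => by simpa using h (Fin.castSucc_lt_castSucc_iff.2 hij)⟩
  · rintro ⟨h, hx⟩ i j
    refine Fin.lastCases ?_ (fun i => ?_) i <;> refine Fin.lastCases ?_ (fun j => ?_) j
    · simp
    · intro hij; exact absurd hij (not_lt.2 (Fin.le_last _))
    · intro _; simpa using h i
    · intro hij; simpa using hx (Fin.castSucc_lt_castSucc_iff.1 hij)

lemma exists_linear_of_coord {X : Type*} [AddCommGroup X] [Module ℝ X] {N : ℕ}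
    {W : X → Fin N → ℝ} (h : ∀ i, ∃ w : X →ₗ[ℝ] ℝ, ∀ p, W p i = W 0 i + w p) :
    ∃ W' : X →ₗ[ℝ] (Fin N → ℝ), ∀ p, W p = W 0 + W' p := by
  choose w hw using h
  exact ⟨LinearMap.pi w, fun p => funext fun i => hw i p⟩

end Tuples

/-- The coordinate `p.1 j` as a linear map. -/
def fstCoord {k l : ℕ} (j : Fin k) : ((Fin k → ℝ) × (Fin l → ℝ)) →ₗ[ℝ] ℝ :=
  LinearMap.proj j ∘ₗ LinearMap.fst ℝ _ _

/-- The coordinate `p.2 j` as a linear map. -/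
def sndCoord {k l : ℕ} (j : Fin l) : ((Fin k → ℝ) × (Fin l → ℝ)) →ₗ[ℝ] ℝ :=
  LinearMap.proj j ∘ₗ LinearMap.snd ℝ _ _

lemma sub_sum_affine {k l : ℕ} (p : (Fin k → ℝ) × (Fin l → ℝ)) :
    1 - ∑ j, p.1 j = (1 - ∑ j, (0 : (Fin k → ℝ) × (Fin l → ℝ)).1 j) +
      (-∑ j, fstCoord (l := l) j) p := by
  simp [fstCoord, sub_eq_add_neg, LinearMap.sum_apply]

/-! ### The four parametrizations and their weight counts -/

section Parametrizations

variable {n : ℕ} {a b : ℝ} {γ : ℝ → Fin (n + 1) → ℝ}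

/-- Weight: `l` moving nodes and `b` give `2 * l + 1 = n + 1`. -/
lemma hullParam_upperEven (hab : a < b) {l : ℕ} (hn : n = 2 * l) :
    HullParam n a b γ (DeltaC l ×ˢ DeltaStar a b l) (upperEven γ b l) (l + 1)
      (Finset.univ.erase (Fin.last l))
      (fun p => Fin.snoc (α := fun _ => ℝ) p.1 (1 - ∑ j, p.1 j))
      (fun p => Fin.snoc (α := fun _ => ℝ) p.2 b) 1 where
  finiteDimensional := inferInstance
  finrank := by simp; omega
  W_affine := exists_linear_of_coord fun i => Fin.lastCases
    ⟨-∑ j, fstCoord j, fun p => by simpa using sub_sum_affine p⟩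
    (fun j => ⟨fstCoord j, fun p => by simp [fstCoord]⟩) i
  T_affine := exists_linear_of_coord fun i => Fin.lastCases
    ⟨0, fun p => by simp⟩ (fun j => ⟨sndCoord j, fun p => by simp [sndCoord]⟩) i
  inj p q h1 h2 := Prod.ext (Fin.snoc_injective2 h1).1 (Fin.snoc_injective2 h2).1
  card := by simp; omega
  sum_W p := by simp [Fin.sum_univ_castSucc]
  fixed i hi := by
    have : i = Fin.last l := by simpa using hi
    subst this
    exact Or.inr fun p => by simp
  eq_sum p := by simp [upperEven, Fin.sum_univ_castSucc]
  mem p hp := by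
    obtain ⟨⟨h1, h2⟩, h3, h4⟩ := hp
    refine ⟨fun i => ?_, fun i => ?_, monotone_snoc (fun j => (h3 j).2) h4⟩
    · refine Fin.lastCases ?_ (fun j => ?_) i
      · simpa using h2
      · simpa using h1 j
    · refine Fin.lastCases ?_ (fun j => ?_) i
      · simpa using hab.le
      · simpa using h3 j
  mem_interior p := by
    rw [interior_prod_eq, mem_prod, mem_interior_deltaC, mem_interior_deltaStar,
      strictMono_snoc_iff]
    constructor
    · rintro ⟨⟨h1, h2⟩, h3, h4⟩
      refine ⟨fun i => ?_, fun i hi => ?_, fun j => (h3 j).2, h4⟩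
      · refine Fin.lastCases ?_ (fun j => ?_) i
        · simpa using h2
        · simpa using h1 j
      · revert hi
        refine Fin.lastCases ?_ (fun j => ?_) i
        · simp
        · intro _; simpa using h3 j
    · rintro ⟨h1, h2, h3, h4⟩
      refine ⟨⟨fun j => by simpa using h1 j.castSucc, by simpa using h1 (Fin.last l)⟩,
        fun j => ?_, h4⟩
      simpa using h2 j.castSucc (by simp)
  isCompact := (isCompact_deltaC l).prod (isCompact_deltaStar a b l)
  interior_nonempty := by
    rw [interior_prod_eq]
    exact (interior_deltaC_nonempty l).prod (interior_deltaStar_nonempty hab l)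
  side := Or.inl ⟨rfl, fun p _ => ⟨Fin.last l, by simp⟩⟩

/-- The fixed node is now `a`; the count `2 * l + 1` is the same. -/
lemma hullParam_lowerEven (hab : a < b) {l : ℕ} (hn : n = 2 * l) :
    HullParam n a b γ (DeltaC l ×ˢ DeltaStar a b l) (lowerEven γ a l) (l + 1)
      (Finset.univ.erase 0)
      (fun p => Fin.cons (1 - ∑ j, p.1 j) p.1)
      (fun p => Fin.cons a p.2) (-1) where
  finiteDimensional := inferInstance
  finrank := by simp; omega
  W_affine := exists_linear_of_coord fun i => Fin.cases
    ⟨-∑ j, fstCoord j, fun p => by simpa using sub_sum_affine p⟩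
    (fun j => ⟨fstCoord j, fun p => by simp [fstCoord]⟩) i
  T_affine := exists_linear_of_coord fun i => Fin.cases
    ⟨0, fun p => by simp⟩ (fun j => ⟨sndCoord j, fun p => by simp [sndCoord]⟩) i
  inj p q h1 h2 := Prod.ext (Fin.cons_injective2 h1).2 (Fin.cons_injective2 h2).2
  card := by simp; omega
  sum_W p := by simp [Fin.sum_univ_succ]
  fixed i hi := by
    have : i = 0 := by simpa using hi
    subst this
    exact Or.inl fun p => by simp
  eq_sum p := by simp [lowerEven, Fin.sum_univ_succ]
  mem p hp := by
    obtain ⟨⟨h1, h2⟩, h3, h4⟩ := hp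
    refine ⟨fun i => ?_, fun i => ?_, monotone_cons (fun j => (h3 j).1) h4⟩
    · refine Fin.cases ?_ (fun j => ?_) i
      · simpa using h2
      · simpa using h1 j
    · refine Fin.cases ?_ (fun j => ?_) i
      · simpa using hab.le
      · simpa using h3 j
  mem_interior p := by
    rw [interior_prod_eq, mem_prod, mem_interior_deltaC, mem_interior_deltaStar,
      strictMono_cons_iff]
    constructor
    · rintro ⟨⟨h1, h2⟩, h3, h4⟩
      refine ⟨fun i => ?_, fun i hi => ?_, fun j => (h3 j).1, h4⟩
      · refine Fin.cases ?_ (fun j => ?_) i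
        · simpa using h2
        · simpa using h1 j
      · revert hi
        refine Fin.cases ?_ (fun j => ?_) i
        · simp
        · intro _; simpa using h3 j
    · rintro ⟨h1, h2, h3, h4⟩
      refine ⟨⟨fun j => by simpa using h1 j.succ, by simpa using h1 0⟩, fun j => ?_, h4⟩
      simpa using h2 j.succ (by simp)
  isCompact := (isCompact_deltaC l).prod (isCompact_deltaStar a b l)
  interior_nonempty := by
    rw [interior_prod_eq]
    exact (interior_deltaC_nonempty l).prod (interior_deltaStar_nonempty hab l)
  side := Or.inr ⟨rfl, fun p hp i => by
    rw [interior_prod_eq, mem_prod, mem_interior_deltaC, mem_interior_deltaStar] at hp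
    refine Fin.cases ?_ (fun j => ?_) i
    · simpa using hab.ne
    · simpa using (hp.2.1 j).2.ne⟩

/-- Weight: `m` moving nodes and both endpoints give `2 * m + 2 = n + 1`. The coefficient `p.1 0` is
moved to the end, since it belongs to the largest node `b`. -/
lemma hullParam_upperOdd (hab : a < b) {m : ℕ} (hn : n = 2 * m + 1) :
    HullParam n a b γ (DeltaC (m + 1) ×ˢ DeltaStar a b m) (upperOdd γ a b m) (m + 1 + 1)
      ((Finset.univ.erase 0).erase (Fin.last (m + 1)))
      (fun p => Fin.cons (1 - ∑ j, p.1 j)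
        (Fin.snoc (α := fun _ => ℝ) (fun j => p.1 j.succ) (p.1 0)))
      (fun p => Fin.cons a (Fin.snoc (α := fun _ => ℝ) p.2 b)) 1 where
  finiteDimensional := inferInstance
  finrank := by simp; omega
  W_affine := exists_linear_of_coord fun i => Fin.cases
    ⟨-∑ j, fstCoord j, fun p => by simpa using sub_sum_affine p⟩
    (fun j => Fin.lastCases ⟨fstCoord 0, fun p => by simp [fstCoord]⟩
      (fun j => ⟨fstCoord j.succ, fun p => by simp [fstCoord]⟩) j) i
  T_affine := exists_linear_of_coord fun i => Fin.cases
    ⟨0, fun p => by simp⟩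
    (fun j => Fin.lastCases ⟨0, fun p => by simp⟩
      (fun j => ⟨sndCoord j, fun p => by simp [sndCoord]⟩) j) i
  inj p q h1 h2 := by
    obtain ⟨h3, h4⟩ := Fin.snoc_injective2 (Fin.cons_injective2 h1).2
    refine Prod.ext (funext fun j => ?_) (Fin.snoc_injective2 (Fin.cons_injective2 h2).2).1
    exact Fin.cases h4 (fun j => congrFun h3 j) j
  card := by
    rw [Finset.card_erase_of_mem (by simp), Finset.card_erase_of_mem (by simp)]
    simp; omega
  sum_W p := by
    rw [Fin.sum_univ_succ]
    simp only [Fin.cons_zero, Fin.cons_succ]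
    rw [Fin.sum_univ_succ p.1, Fin.sum_univ_castSucc]
    simp only [Fin.snoc_castSucc, Fin.snoc_last]
    ring
  fixed i hi := by
    revert hi
    refine Fin.cases (fun _ => Or.inl fun p => by simp) (fun j => ?_) i
    refine Fin.lastCases (fun _ => Or.inr fun p => by simp) (fun j hi => ?_) j
    exact absurd hi (by simp [Fin.ext_iff, j.2.ne])
  eq_sum p := by
    rw [upperOdd, Fin.sum_univ_succ (n := m + 1)]
    simp only [Fin.cons_zero, Fin.cons_succ]
    rw [Fin.sum_univ_succ p.1, Fin.sum_univ_castSucc]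
    simp only [Fin.snoc_castSucc, Fin.snoc_last, add_assoc]
  mem p hp := by
    obtain ⟨⟨h1, h2⟩, h3, h4⟩ := hp
    refine ⟨fun i => ?_, fun i => ?_, monotone_cons (fun j => ?_)
      (monotone_snoc (fun j => (h3 j).2) h4)⟩
    · refine Fin.cases ?_ (fun j => Fin.lastCases ?_ (fun j => ?_) j) i
      · simpa using h2
      · simpa using h1 0
      · simpa using h1 j.succ
    · refine Fin.cases ?_ (fun j => Fin.lastCases ?_ (fun j => ?_) j) i
      · simpa using hab.le
      · simpa using hab.le
      · simpa using h3 j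
    · refine Fin.lastCases ?_ (fun j => ?_) j
      · simpa using hab.le
      · simpa using (h3 j).1
  mem_interior p := by
    rw [interior_prod_eq, mem_prod, mem_interior_deltaC, mem_interior_deltaStar,
      strictMono_cons_iff, strictMono_snoc_iff]
    constructor
    · rintro ⟨⟨h1, h2⟩, h3, h4⟩
      refine ⟨fun i => ?_, fun i hi => ?_, fun j => ?_, fun j => (h3 j).2, h4⟩
      · refine Fin.cases ?_ (fun j => Fin.lastCases ?_ (fun j => ?_) j) i
        · simpa using h2
        · simpa using h1 0
        · simpa using h1 j.succ
      · revert hi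
        refine Fin.cases ?_ (fun j => Fin.lastCases ?_ (fun j => ?_) j) i
        · simp
        · simp
        · intro _; simpa using h3 j
      · refine Fin.lastCases ?_ (fun j => ?_) j
        · simpa using hab
        · simpa using (h3 j).1
    · rintro ⟨h1, h2, h3, h4, h5⟩
      refine ⟨⟨fun j => ?_, by simpa using h1 0⟩, fun j => ?_, h5⟩
      · refine Fin.cases ?_ (fun j => ?_) j
        · simpa using h1 (Fin.last m).succ
        · simpa using h1 j.castSucc.succ
      · simpa using h2 j.castSucc.succ (by simp [Fin.ext_iff, j.2.ne])
  isCompact := (isCompact_deltaC _).prod (isCompact_deltaStar a b m)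
  interior_nonempty := by
    rw [interior_prod_eq]
    exact (interior_deltaC_nonempty _).prod (interior_deltaStar_nonempty hab m)
  side := Or.inl ⟨rfl, fun p _ => ⟨(Fin.last m).succ, by
    rw [Fin.cons_succ, Fin.snoc_last]⟩⟩

/-- Weight: `m + 1` moving nodes and no endpoint give `2 * m + 2 = n + 1`. -/
lemma hullParam_lowerOdd (hab : a < b) {m : ℕ} (hn : n = 2 * m + 1) :
    HullParam n a b γ (DeltaC m ×ˢ DeltaStar a b (m + 1)) (lowerOdd γ m) (m + 1)
      Finset.univ (fun p => Fin.cons (1 - ∑ j, p.1 j) p.1) (fun p => p.2) (-1) where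
  finiteDimensional := inferInstance
  finrank := by simp; omega
  W_affine := exists_linear_of_coord fun i => Fin.cases
    ⟨-∑ j, fstCoord j, fun p => by simpa using sub_sum_affine p⟩
    (fun j => ⟨fstCoord j, fun p => by simp [fstCoord]⟩) i
  T_affine := exists_linear_of_coord fun i => ⟨sndCoord i, fun p => by simp [sndCoord]⟩
  inj p q h1 h2 := Prod.ext (Fin.cons_injective2 h1).2 h2
  card := by simp; omega
  sum_W p := by simp [Fin.sum_univ_succ]
  fixed i hi := absurd (Finset.mem_univ i) hi
  eq_sum p := by simp [lowerOdd, Fin.sum_univ_succ]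
  mem p hp := by
    obtain ⟨⟨h1, h2⟩, h3, h4⟩ := hp
    refine ⟨fun i => ?_, h3, h4⟩
    refine Fin.cases ?_ (fun j => ?_) i
    · simpa using h2
    · simpa using h1 j
  mem_interior p := by
    rw [interior_prod_eq, mem_prod, mem_interior_deltaC, mem_interior_deltaStar]
    constructor
    · rintro ⟨⟨h1, h2⟩, h3, h4⟩
      refine ⟨fun i => ?_, fun i _ => h3 i, h4⟩
      refine Fin.cases ?_ (fun j => ?_) i
      · simpa using h2
      · simpa using h1 j
    · rintro ⟨h1, h2, h3⟩
      exact ⟨⟨fun j => by simpa using h1 j.succ, by simpa using h1 0⟩,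
        fun j => h2 j (Finset.mem_univ j), h3⟩
  isCompact := (isCompact_deltaC _).prod (isCompact_deltaStar a b _)
  interior_nonempty := by
    rw [interior_prod_eq]
    exact (interior_deltaC_nonempty _).prod (interior_deltaStar_nonempty hab _)
  side := Or.inr ⟨rfl, fun p hp i => by
    rw [interior_prod_eq, mem_prod, mem_interior_deltaC, mem_interior_deltaStar] at hp
    exact (hp.2.1 i).2.ne⟩

end Parametrizations

/-! ### The theorem -/

theorem theorem2p1 (n : ℕ) (hn : 1 ≤ n) (a b : ℝ) (hab : a < b) (γ : ℝ → Fin (n + 1) → ℝ)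
    (hγ : ContinuousOn γ (Set.Icc a b))
    (hγ' : ContDiffOn ℝ (n + 1 : ℕ) γ (Set.Ioo a b))
    (htor : TotallyPositiveTorsion γ a b) :
    (∀ ℓ : ℕ, n = 2 * ℓ →
      DescribesHull γ a b
        (DeltaC ℓ ×ˢ DeltaStar a b ℓ) (upperEven γ b ℓ)
        (DeltaC ℓ ×ˢ DeltaStar a b ℓ) (lowerEven γ a ℓ)
        (convexHull ℝ ((fun t => bar (γ t)) '' Set.Icc a b))) ∧
    (∀ m : ℕ, n = 2 * m + 1 →
      DescribesHull γ a b
        (DeltaC (m + 1) ×ˢ DeltaStar a b m) (upperOdd γ a b m)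
        (DeltaC m ×ˢ DeltaStar a b (m + 1)) (lowerOdd γ m)
        (convexHull ℝ ((fun t => bar (γ t)) '' Set.Icc a b))) := by
  have h : IsTorsionCurve n a b γ := ⟨hab, hγ, hγ', htor.isTorsionPositive hγ hγ'⟩
  refine ⟨fun l hl => ?_, fun m hm => ?_⟩
  · exact (hullParam_upperEven hab hl).describesHull (hullParam_lowerEven hab hl) h hn
      fun h1 => by omega
  · refine (hullParam_upperOdd hab hm).describesHull (hullParam_lowerOdd hab hm) h hn
      fun h1 t ht => ?_
    -- For `n = 1` the lower map has a single node of coefficient `1`, so it is the curve itself.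
    obtain rfl : m = 0 := by omega
    exact ⟨(0, fun _ => t), ⟨⟨by simp, by simp⟩, fun _ => ht, monotone_const⟩, by simp [lowerOdd]⟩
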